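/- Let $\mathbb H=\langle a,b\mid aba^{-1}b^{-1}\text{ is central}\rangle$ be the discrete Heisenberg group, let $d_W$ be the left-invariant word metric on $\mathbb H$ associated to the generating set $\{a,b,a^{-1},b^{-1}\}$, and for real $R\ge 1$ let $B_R=\{x\in\mathbb H:\ d_W(e,x)\le R\}$, where $e$ is the identity element. For a real Banach space $(X,\|\cdot\|)$, let $c_X(B_R)\in[1,\infty]$ be the infimum over those $D\ge 1$ such that there exists $f:B_R\to X$ satisfying $$d_W(x,y)\le \|f(x)-f(y)\|\le D\,d_W(x,y)\qquad\text{for all } x,y\in B_R$$ (with $\inf\emptyset=\infty$). **Theorem 1.3.** There exists a universal constant $c>0$ with the following property. Let $(X,\|\cdot\|)$ be a real Banach space and let $p\ge 2$ be a real number such that, for some $K>0$, $$\left\|\frac{x+y}{2}\right\|^p\le \frac{\|x\|^p+\|y\|^p}{2}-\frac{1}{K^p}\left\|\frac{x-y}{2}\right\|^p\qquad\text{for all } x,y\in X,$$ and let $K_p(X)$ be the infimum over all $K>0$ for which this inequality holds. Then for every real $R\ge 4$, $$c_X(B_R)\ \ge\ \frac{c}{K_p(X)}\left(\frac{\log R}{\log\log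 R}\right)^{1/p},$$ where, for the zero space $X=\{0\}$, for which $K_p(X)=0$, the right-hand side is read as $\infty$. In particular, $c$ does not depend on $X$, $p$ or $R$. -/

import Mathlib

open scoped ENNReal

namespace HeisDistortion

/-- The word `a b a⁻¹ b⁻¹` in the free group on two letters `a = 0`, `b = 1`. -/
def freeComm : FreeGroup (Fin 2) :=
  FreeGroup.of 0 * FreeGroup.of 1 * (FreeGroup.of 0)⁻¹ * (FreeGroup.of 1)⁻¹

/-- The relations saying that `a b a⁻¹ b⁻¹` commutes with every word. -/
def heisRels : Set (FreeGroup (Fin 2)) :=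
  {r | ∃ w : FreeGroup (Fin 2), r = freeComm * w * freeComm⁻¹ * w⁻¹}

/-- The discrete Heisenberg group `⟨a, b | a b a⁻¹ b⁻¹ is central⟩`. -/
abbrev Heis : Type := PresentedGroup heisRels

/-- The canonical generator `a`. -/
def genA : Heis := PresentedGroup.of 0

/-- The canonical generator `b`. -/
def genB : Heis := PresentedGroup.of 1

/-- The symmetric generating set `S = {a, b, a⁻¹, b⁻¹}`. -/
def genSet : Set Heis := {genA, genB, genA⁻¹, genB⁻¹}

/-- Every element of the group is a product of elements of `S`, so the infimum in the next
definition is over a nonempty set. -/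
theorem exists_word (g : Heis) : ∃ l : List Heis, (∀ s ∈ l, s ∈ genSet) ∧ l.prod = g := by
  have hinv : ∀ s ∈ genSet, s⁻¹ ∈ genSet := by
    intro s hs
    simp only [genSet, Set.mem_insert_iff, Set.mem_singleton_iff] at hs ⊢
    rcases hs with rfl | rfl | rfl | rfl <;> simp
  have hg : g ∈ Subgroup.closure (Set.range (PresentedGroup.of (rels := heisRels))) := by
    rw [PresentedGroup.closure_range_of]
    trivial
  induction hg using Subgroup.closure_induction with
  | mem x hx =>
    obtain ⟨i, rfl⟩ := hx
    refine ⟨[PresentedGroup.of i], ?_, by simp⟩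
    intro s hs
    rw [List.mem_singleton] at hs
    subst hs
    fin_cases i
    · exact Or.inl rfl
    · exact Or.inr (Or.inl rfl)
  | one => exact ⟨[], by simp, by simp⟩
  | mul x y _ _ hx hy =>
    obtain ⟨l, hl, rfl⟩ := hx
    obtain ⟨m, hm, rfl⟩ := hy
    refine ⟨l ++ m, ?_, by simp⟩
    intro s hs
    rcases List.mem_append.1 hs with h | h
    · exact hl s h
    · exact hm s h
  | inv x _ hx =>
    obtain ⟨l, hl, rfl⟩ := hx
    refine ⟨(l.map (fun s => s⁻¹)).reverse, ?_, (List.prod_inv_reverse l).symm⟩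
    intro s hs
    rw [List.mem_reverse, List.mem_map] at hs
    obtain ⟨t, ht, rfl⟩ := hs
    exact hinv t (hl t ht)

/-- Word length: the least length of a word in the letters `S` that represents `g`. -/
noncomputable def wordLength (g : Heis) : ℕ :=
  sInf {n : ℕ | ∃ l : List Heis, l.length = n ∧ (∀ s ∈ l, s ∈ genSet) ∧ l.prod = g}

/-- The left-invariant word metric `d_W` associated to `S`. -/
noncomputable def wordDist (x y : Heis) : ℕ := wordLength (x⁻¹ * y)

/-- The ball `B_R` of radius `R` about the identity. -/
def ball (R : ℝ) : Set Heis := {x | (wordDist 1 x : ℝ) ≤ R}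

/-- The infimum over those `D ≥ 1` for which there is `f : B_R → X` with
`d_W(x, y) ≤ ‖f x - f y‖ ≤ D d_W(x, y)` on `B_R`; it is `∞` if there is no such `D`. -/
noncomputable def distortion (X : Type*) [NormedAddCommGroup X] (R : ℝ) : ℝ≥0∞ :=
  ⨅ (D : ℝ) (_ : 1 ≤ D) (_ : ∃ f : ball R → X, ∀ x y : ball R,
      (wordDist x y : ℝ) ≤ ‖f x - f y‖ ∧ ‖f x - f y‖ ≤ D * (wordDist x y : ℝ)),
    ENNReal.ofReal D

/-- The `p`-convexity inequality with constant `K`. -/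
def PConvexWith (X : Type*) [NormedAddCommGroup X] [NormedSpace ℝ X] (p K : ℝ) : Prop :=
  ∀ x y : X, ‖(2⁻¹ : ℝ) • (x + y)‖ ^ p ≤
    (‖x‖ ^ p + ‖y‖ ^ p) / 2 - 1 / K ^ p * ‖(2⁻¹ : ℝ) • (x - y)‖ ^ p

/-- `K_p(X)`: the infimum over those `K > 0` for which the `p`-convexity inequality holds. -/
noncomputable def pConvexConst (X : Type*) [NormedAddCommGroup X] [NormedSpace ℝ X]
    (p : ℝ) : ℝ :=
  sInf {K : ℝ | 0 < K ∧ PConvexWith X p K}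

end HeisDistortion

namespace HeisDistortion

/-! ### Word length -/

/-! A map of small distortion is nearly affine along the cosets of `⟨a⟩` and `⟨b⟩` at some scale
`m`, and the commutation relation forbids this.

Let `A = B ^ 2`. Average `‖F (x * g) - F x‖ ^ p` over a large box for `g = a ^ (A ^ j)` and divide
by `(D * A ^ j) ^ p`. This quantity is at most 1 at `j = 0`. Up to a boundary error `1 / N` it
decreases in `j` by Jensen's inequality, and `p`-convexity (`PConvexWith.sum_deviation_le`) bounds
the `p`-th moment of the deviation of the increments from their mean along a progression of length
`A` by the drop. Telescoping over `N` scales, for `a` and `b` together, gives one scale at which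
both drops are `O(1 / N)` (`exists_scale`).

At that scale, put `m = A ^ j`. Two parallel progressions of length `A * m`, starting `O(m)` apart,
stay within `O(B * m)` of each other, because their central separation is `O(A * m ^ 2)` and the
word metric sees its square root. Their mean increments therefore differ by `O(D * m / B)`. So the
`a ^ m` increments on opposite sides of a parallelogram nearly agree, and so do the `b ^ m`
increments. The parallelogram fails to close by `c ^ (m ^ 2)`, whose length is at least `m`; hence
`1 ≤ D * (160 * K / N ^ (1 / p) + 48 / B)` (`Model.single_scale`).

All this fits in `B_R` once `R ≥ 240 * N * B ^ (2 * N)`. Taking `B ≈ √(log R)` and `N ≈ log R / (10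
* log log R)` gives the bound. -/

theorem wordLength_le_of_word {l : List Heis} (hl : ∀ s ∈ l, s ∈ genSet) :
    wordLength l.prod ≤ l.length :=
  Nat.sInf_le ⟨l, rfl, hl, rfl⟩

theorem exists_word_length_eq (g : Heis) :
    ∃ l : List Heis, l.length = wordLength g ∧ (∀ s ∈ l, s ∈ genSet) ∧ l.prod = g := by
  obtain ⟨l, hl, hg⟩ := exists_word g
  exact Nat.sInf_mem
    (s := {n : ℕ | ∃ l : List Heis, l.length = n ∧ (∀ s ∈ l, s ∈ genSet) ∧ l.prod = g})
    ⟨l.length, l, rfl, hl, hg⟩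

theorem wordLength_one : wordLength 1 = 0 :=
  Nat.le_zero.1 (wordLength_le_of_word (l := []) (by simp))

theorem wordLength_mul_le (g h : Heis) : wordLength (g * h) ≤ wordLength g + wordLength h := by
  obtain ⟨l, hl, hls, rfl⟩ := exists_word_length_eq g
  obtain ⟨k, hk, hks, rfl⟩ := exists_word_length_eq h
  rw [← hl, ← hk, ← List.length_append, ← List.prod_append]
  exact wordLength_le_of_word fun s hs => (List.mem_append.1 hs).elim (hls s) (hks s)

theorem inv_mem_genSet {s : Heis} (hs : s ∈ genSet) : s⁻¹ ∈ genSet := by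
  simp only [genSet, Set.mem_insert_iff, Set.mem_singleton_iff] at hs ⊢
  rcases hs with rfl | rfl | rfl | rfl <;> simp

theorem wordLength_inv_le (g : Heis) : wordLength g⁻¹ ≤ wordLength g := by
  obtain ⟨l, hl, hls, rfl⟩ := exists_word_length_eq g
  rw [← hl, List.prod_inv_reverse]
  refine (wordLength_le_of_word ?_).trans (by simp)
  intro s hs
  rw [List.mem_reverse, List.mem_map] at hs
  obtain ⟨t, ht, rfl⟩ := hs
  exact inv_mem_genSet (hls t ht)

theorem wordLength_pow_le {g : Heis} (hg : g ∈ genSet) (n : ℕ) : wordLength (g ^ n) ≤ n := by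
  have h := wordLength_le_of_word (l := List.replicate n g)
    fun s hs => (List.eq_of_mem_replicate hs) ▸ hg
  simpa using h

theorem wordLength_zpow_le {g : Heis} (hg : g ∈ genSet) (n : ℤ) :
    wordLength (g ^ n) ≤ n.natAbs := by
  obtain ⟨k, rfl | rfl⟩ := n.eq_nat_or_neg
  · simpa using wordLength_pow_le hg k
  · have h := wordLength_pow_le (inv_mem_genSet hg) k
    simpa using h

theorem genA_mem_genSet : genA ∈ genSet := Or.inl rfl

theorem genB_mem_genSet : genB ∈ genSet := Or.inr (Or.inl rfl)

/-! ### Commutation relations -/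

/-- The central commutator `a b a⁻¹ b⁻¹`. -/
def genC : Heis := genA * genB * genA⁻¹ * genB⁻¹

theorem genC_commute (g : Heis) : Commute genC g := by
  obtain ⟨w, rfl⟩ := PresentedGroup.mk_surjective heisRels g
  have h : PresentedGroup.mk heisRels (freeComm * w * freeComm⁻¹ * w⁻¹) = 1 :=
    PresentedGroup.one_of_mem ⟨w, rfl⟩
  have hc : PresentedGroup.mk heisRels freeComm = genC := by
    simp [freeComm, genC, genA, genB, PresentedGroup.of]
  rw [map_mul, map_mul, map_mul, map_inv, map_inv, hc] at h
  rw [mul_inv_eq_one, mul_inv_eq_iff_eq_mul] at h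
  exact h

theorem genA_mul_zpow_genB (t : ℤ) : genA * genB ^ t = genB ^ t * genC ^ t * genA := by
  have h1 : genA * genB * genA⁻¹ = genB * genC := by
    rw [← (genC_commute genB).eq, genC]
    group
  have h2 : genA * genB ^ t * genA⁻¹ = (genB * genC) ^ t := by
    rw [← h1, conj_zpow]
  rw [(genC_commute genB).symm.mul_zpow] at h2
  rw [← h2]
  group

theorem zpow_genA_mul_zpow_genB (s t : ℤ) :
    genA ^ s * genB ^ t = genB ^ t * genA ^ s * genC ^ (s * t) := by
  have h2 : (genB ^ t)⁻¹ * genA * genB ^ t = genA * genC ^ t := by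
    rw [mul_assoc, genA_mul_zpow_genB, ((genC_commute genA).zpow_left t).symm.eq]
    group
  have h3 : (genB ^ t)⁻¹ * genA ^ s * genB ^ t = (genA * genC ^ t) ^ s := by
    rw [← h2]
    have := conj_zpow (a := (genB ^ t)⁻¹) (b := genA) (i := s)
    rw [inv_inv] at this
    exact this.symm
  rw [((genC_commute genA).zpow_left t).symm.mul_zpow, ← zpow_mul, mul_comm t s] at h3
  rw [mul_assoc (genB ^ t), ← h3]
  group

/-! ### The integral model -/

/-- Integer triples, standing for the normal forms `b ^ y * a ^ x * c ^ z`. -/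
@[ext] structure Model where
  x : ℤ
  y : ℤ
  z : ℤ

namespace Model

instance : Mul Model := ⟨fun g h => ⟨g.x + h.x, g.y + h.y, g.z + h.z + g.x * h.y⟩⟩
instance : One Model := ⟨⟨0, 0, 0⟩⟩
instance : Inv Model := ⟨fun g => ⟨-g.x, -g.y, -g.z + g.x * g.y⟩⟩

@[simp] theorem mul_x (g h : Model) : (g * h).x = g.x + h.x := rfl
@[simp] theorem mul_y (g h : Model) : (g * h).y = g.y + h.y := rfl
@[simp] theorem mul_z (g h : Model) : (g * h).z = g.z + h.z + g.x * h.y := rfl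
@[simp] theorem one_x : (1 : Model).x = 0 := rfl
@[simp] theorem one_y : (1 : Model).y = 0 := rfl
@[simp] theorem one_z : (1 : Model).z = 0 := rfl
@[simp] theorem inv_x (g : Model) : g⁻¹.x = -g.x := rfl
@[simp] theorem inv_y (g : Model) : g⁻¹.y = -g.y := rfl
@[simp] theorem inv_z (g : Model) : g⁻¹.z = -g.z + g.x * g.y := rfl

instance : Group Model :=
  Group.ofLeftAxioms (fun g h k => by ext <;> simp <;> ring) (fun g => by ext <;> simp)
    (fun g => by ext <;> simp)

theorem pow_of_y_eq_zero {g : Model} (hg : g.y = 0) (n : ℕ) :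
    g ^ n = ⟨n * g.x, 0, n * g.z⟩ := by
  induction n with
  | zero => ext <;> simp
  | succ k ih => rw [pow_succ, ih]; ext <;> simp [hg] <;> ring

theorem pow_of_x_eq_zero {g : Model} (hg : g.x = 0) (n : ℕ) :
    g ^ n = ⟨0, n * g.y, n * g.z⟩ := by
  induction n with
  | zero => ext <;> simp
  | succ k ih => rw [pow_succ, ih]; ext <;> simp [hg] <;> ring

/-- The homomorphism sending a triple to its normal form. -/
def toHeis : Model →* Heis :=
  MonoidHom.mk' (fun g => genB ^ g.y * genA ^ g.x * genC ^ g.z) (by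
    intro g h
    have hc (n : ℤ) (k : Heis) : genC ^ n * k = k * genC ^ n := ((genC_commute k).zpow_left n).eq
    simp only [mul_x, mul_y, mul_z]
    symm
    calc genB ^ g.y * genA ^ g.x * genC ^ g.z * (genB ^ h.y * genA ^ h.x * genC ^ h.z)
        = genB ^ g.y * (genA ^ g.x * genB ^ h.y) * genA ^ h.x * (genC ^ h.z * genC ^ g.z) := by
          rw [mul_assoc _ (genC ^ g.z), hc]; simp only [mul_assoc]
      _ = genB ^ g.y * genB ^ h.y * genA ^ g.x *
            (genC ^ (g.x * h.y) * (genA ^ h.x * (genC ^ h.z * genC ^ g.z))) := by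
          rw [zpow_genA_mul_zpow_genB]; simp only [mul_assoc]
      _ = _ := by
          rw [hc (g.x * h.y), hc h.z (genC ^ g.z)]; simp only [zpow_add, mul_assoc])

theorem toHeis_apply (g : Model) : toHeis g = genB ^ g.y * genA ^ g.x * genC ^ g.z := rfl

/-- The inverse homomorphism. -/
def ofHeis : Heis →* Model :=
  PresentedGroup.toGroup (f := ![⟨1, 0, 0⟩, ⟨0, 1, 0⟩]) (by
    rintro r ⟨w, rfl⟩
    simp only [freeComm, map_mul, map_inv, FreeGroup.lift_apply_of]
    ext <;> simp)

theorem ofHeis_genA : ofHeis genA = ⟨1, 0, 0⟩ := PresentedGroup.toGroup.of _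

theorem ofHeis_genB : ofHeis genB = ⟨0, 1, 0⟩ := PresentedGroup.toGroup.of _

theorem ofHeis_genC : ofHeis genC = ⟨0, 0, 1⟩ := by
  simp only [genC, map_mul, map_inv, ofHeis_genA, ofHeis_genB]
  ext <;> simp

/-- Appending a letter on the right changes `z` by at most `|x|`, which is at most the current
length `k`, and `k ^ 2 + k ≤ (k + 1) ^ 2`. -/
theorem ofHeis_word_bound (l : List Heis) (hl : ∀ s ∈ l, s ∈ genSet) :
    |(ofHeis l.prod).x| ≤ l.length ∧ |(ofHeis l.prod).z| ≤ (l.length : ℤ) ^ 2 := by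
  induction l using List.reverseRecOn with
  | nil => simp
  | append_singleton l s ih =>
    obtain ⟨h1, h2⟩ := ih fun t ht => hl t (by simp [ht])
    have hs := hl s (by simp)
    rw [List.prod_append, List.prod_singleton, map_mul]
    simp only [mul_x, mul_z, List.length_append, List.length_singleton, Nat.cast_add, Nat.cast_one]
    generalize (ofHeis l.prod).x = x at *
    generalize (ofHeis l.prod).z = z at *
    have hk : (0 : ℤ) ≤ l.length := by positivity
    generalize (l.length : ℤ) = k at *
    rw [abs_le] at h1 h2
    simp only [genSet, Set.mem_insert_iff, Set.mem_singleton_iff] at hs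
    rcases hs with rfl | rfl | rfl | rfl <;>
      simp only [map_inv, ofHeis_genA, ofHeis_genB, inv_x, inv_z, inv_y, abs_le] <;>
      refine ⟨⟨?_, ?_⟩, ⟨?_, ?_⟩⟩ <;> nlinarith

theorem le_wordLength_center (m : ℕ) : m ≤ wordLength (toHeis ⟨0, 0, (m : ℤ) ^ 2⟩) := by
  obtain ⟨l, hl, hls, hp⟩ := exists_word_length_eq (toHeis ⟨0, 0, (m : ℤ) ^ 2⟩)
  have h := (ofHeis_word_bound l hls).2
  have hz : (ofHeis l.prod).z = (m : ℤ) ^ 2 := by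
    rw [hp, toHeis_apply]
    obtain ⟨k, hk⟩ : ∃ k : ℕ, (m : ℤ) ^ 2 = k := ⟨m ^ 2, by simp⟩
    simp [hk, ofHeis_genC, pow_of_x_eq_zero]
  rw [hz, hl, abs_of_nonneg (by positivity)] at h
  exact_mod_cast (abs_le_of_sq_le_sq' h (by positivity)).2

theorem wordLength_commutator_le (s t : ℤ) :
    wordLength (genC ^ (s * t)) ≤ 2 * (s.natAbs + t.natAbs) := by
  have h : genC ^ (s * t) = (genA ^ s)⁻¹ * ((genB ^ t)⁻¹ * (genA ^ s * genB ^ t)) := by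
    rw [zpow_genA_mul_zpow_genB]; group
  rw [h]
  have h1 := wordLength_mul_le (genA ^ s)⁻¹ ((genB ^ t)⁻¹ * (genA ^ s * genB ^ t))
  have h2 := wordLength_mul_le (genB ^ t)⁻¹ (genA ^ s * genB ^ t)
  have h3 := wordLength_mul_le (genA ^ s) (genB ^ t)
  have h4 := wordLength_inv_le (genA ^ s)
  have h5 := wordLength_inv_le (genB ^ t)
  have h6 := wordLength_zpow_le genA_mem_genSet s
  have h7 := wordLength_zpow_le genB_mem_genSet t
  omega

/-- Division with remainder writes `c ^ k` as the commutators `c ^ (n * q)` and `c ^ (r * 1)`, both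
of cost linear in `n`. This is the square-root distortion of the centre. -/
theorem wordLength_genC_zpow_le {n : ℤ} (hn : 1 ≤ n) {k C : ℤ} (hk : |k| ≤ C * n ^ 2) :
    (wordLength (genC ^ k) : ℤ) ≤ (6 + 2 * C) * n := by
  have h1 := wordLength_mul_le (genC ^ (n * (k / n))) (genC ^ (k % n * 1))
  rw [← zpow_add, mul_one, Int.mul_ediv_add_emod] at h1
  have h2 := wordLength_commutator_le n (k / n)
  have h3 := wordLength_commutator_le (k % n) 1
  rw [mul_one] at h3
  have h4 := Int.emod_nonneg k (by omega : n ≠ 0)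
  have h5 := Int.emod_lt_of_pos k (by omega : 0 < n)
  have h6 : |k / n| ≤ C * n + 1 := by
    have h7 := Int.mul_ediv_add_emod k n
    rw [abs_le] at hk ⊢
    constructor
    · by_contra! h; nlinarith
    · by_contra! h; nlinarith
  have h8 : ((k / n).natAbs : ℤ) = |k / n| := Int.natCast_natAbs _
  have h9 : (1 : ℤ).natAbs = 1 := rfl
  have : ((2 * (n.natAbs + (k / n).natAbs) + 2 * ((k % n).natAbs + 1) : ℕ) : ℤ)
      ≤ (6 + 2 * C) * n := by
    push_cast
    rw [abs_of_nonneg h4, abs_of_nonneg (by omega : 0 ≤ n)]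
    have : (6 + 2 * C) * n = 6 * n + 2 * (C * n) := by ring
    omega
  omega

theorem wordLength_toHeis_le (g : Model) {n : ℤ} (hn : 1 ≤ n) {C : ℤ} (hx : |g.x| ≤ n)
    (hy : |g.y| ≤ n) (hz : |g.z| ≤ C * n ^ 2) :
    (wordLength (toHeis g) : ℝ) ≤ (8 + 2 * C) * n := by
  have h1 := wordLength_mul_le (genB ^ g.y * genA ^ g.x) (genC ^ g.z)
  have h2 := wordLength_mul_le (genB ^ g.y) (genA ^ g.x)
  have h3 := wordLength_zpow_le genA_mem_genSet g.x
  have h4 := wordLength_zpow_le genB_mem_genSet g.y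
  have h5 := wordLength_genC_zpow_le hn hz
  have h6 : (wordLength (toHeis g) : ℤ) ≤ (8 + 2 * C) * n := by
    rw [toHeis_apply]
    have : (8 + 2 * C) * n = (6 + 2 * C) * n + 2 * n := by ring
    have := Int.natCast_natAbs g.x
    have := Int.natCast_natAbs g.y
    omega
  exact_mod_cast h6

end Model

theorem genA_ne_one : genA ≠ 1 := fun h => by
  have := congrArg Model.x (Model.ofHeis_genA.symm.trans (congrArg Model.ofHeis h))
  simp at this

theorem wordLength_pos {g : Heis} (hg : g ≠ 1) : 0 < wordLength g := by
  obtain ⟨l, hl, -, rfl⟩ := exists_word_length_eq g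
  rw [← hl, List.length_pos_iff]
  rintro rfl
  exact hg rfl

/-! ### Consequences of `p`-convexity -/

section Convexity

variable {X : Type*} [NormedAddCommGroup X] [NormedSpace ℝ X] {p K : ℝ}

theorem norm_mean_rpow_le (hp : 1 ≤ p) {A : ℕ} (hA : 0 < A) (V : ℕ → X) :
    A * ‖(A : ℝ)⁻¹ • ∑ i ∈ Finset.range A, V i‖ ^ p ≤ ∑ i ∈ Finset.range A, ‖V i‖ ^ p := by
  have hA' : (0 : ℝ) < A := by exact_mod_cast hA
  have h1 : ‖(A : ℝ)⁻¹ • ∑ i ∈ Finset.range A, V i‖ ≤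
      ∑ i ∈ Finset.range A, (A : ℝ)⁻¹ * ‖V i‖ := by
    rw [Finset.smul_sum]
    refine (norm_sum_le _ _).trans (Finset.sum_le_sum fun i _ => ?_)
    rw [norm_smul, Real.norm_of_nonneg (by positivity)]
  have h2 := Real.rpow_arith_mean_le_arith_mean_rpow (Finset.range A) (fun _ => (A : ℝ)⁻¹)
    (fun i => ‖V i‖) (fun _ _ => by positivity) (by simp [hA'.ne']) (fun _ _ => norm_nonneg _) hp
  have h3 := (Real.rpow_le_rpow (norm_nonneg _) h1 (by linarith)).trans h2
  rw [← Finset.mul_sum] at h3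
  calc _ ≤ A * ((A : ℝ)⁻¹ * ∑ i ∈ Finset.range A, ‖V i‖ ^ p) := by gcongr
    _ = _ := by field_simp

/-- The `p`-th moment about the mean is controlled by the defect in Jensen's inequality. -/
theorem PConvexWith.sum_deviation_le (hX : PConvexWith X p K) (hp : 1 ≤ p) (hK : 0 < K) {A : ℕ}
    (hA : 0 < A) (U : ℕ → X) {u : X} (hu : u = (A : ℝ)⁻¹ • ∑ i ∈ Finset.range A, U i) :
    ∑ i ∈ Finset.range A, ‖U i - u‖ ^ p ≤
      (2 * K) ^ p * ((∑ i ∈ Finset.range A, ‖U i‖ ^ p) - A * ‖u‖ ^ p) := by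
  have hA' : (0 : ℝ) < A := by exact_mod_cast hA
  have h1 := norm_mean_rpow_le hp hA fun i => (2⁻¹ : ℝ) • (U i + u)
  -- The midpoints of `U i` and `u` again have mean `u`, so Jensen bounds their `p`-th powers below
  -- by `A * ‖u‖ ^ p`, while `p`-convexity bounds them above with a gain.
  have h2 : (A : ℝ)⁻¹ • ∑ i ∈ Finset.range A, (2⁻¹ : ℝ) • (U i + u) = u := by
    rw [← Finset.smul_sum, Finset.sum_add_distrib, smul_comm, smul_add, ← hu, Finset.sum_const,
      Finset.card_range, ← Nat.cast_smul_eq_nsmul ℝ, inv_smul_smul₀ hA'.ne', ← two_smul ℝ u,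
      inv_smul_smul₀ two_ne_zero]
  rw [h2] at h1
  have h3 : ∑ i ∈ Finset.range A, ‖(2⁻¹ : ℝ) • (U i + u)‖ ^ p ≤
      ∑ i ∈ Finset.range A, ((‖U i‖ ^ p + ‖u‖ ^ p) / 2 - ‖U i - u‖ ^ p / (2 * K) ^ p) := by
    refine Finset.sum_le_sum fun i _ => (hX (U i) u).trans_eq ?_
    rw [norm_smul, Real.norm_of_nonneg (by norm_num), Real.mul_rpow (by norm_num) (norm_nonneg _),
      Real.mul_rpow (by norm_num) hK.le, Real.inv_rpow (by norm_num)]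
    field_simp
  rw [Finset.sum_sub_distrib, ← Finset.sum_div, ← Finset.sum_div, Finset.sum_add_distrib,
    Finset.sum_const, Finset.card_range, nsmul_eq_mul] at h3
  have hc : 0 < (2 * K) ^ p := by positivity
  have h4 : (∑ i ∈ Finset.range A, ‖U i - u‖ ^ p) / (2 * K) ^ p ≤
      ((∑ i ∈ Finset.range A, ‖U i‖ ^ p) - A * ‖u‖ ^ p) / 2 := by linarith
  rw [div_le_iff₀ hc] at h4
  -- The defect is nonnegative, so the spare factor `1 / 2` can be dropped.
  have h5 := norm_mean_rpow_le hp hA U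
  rw [← hu] at h5
  calc _ ≤ _ := h4
    _ ≤ ((∑ i ∈ Finset.range A, ‖U i‖ ^ p) - A * ‖u‖ ^ p) * (2 * K) ^ p := by
        gcongr; linarith
    _ = _ := mul_comm _ _

/-- The pair `x, -x` has midpoint zero, which forces `1 / K ^ p ≤ 1`. -/
theorem PConvexWith.one_le [Nontrivial X] (hX : PConvexWith X p K) (hp : 0 < p) (hK : 0 < K) :
    1 ≤ K := by
  obtain ⟨x, hx⟩ := exists_ne (0 : X)
  have h := hX x (-x)
  have e : (2⁻¹ : ℝ) • (x - -x) = x := by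
    rw [sub_neg_eq_add, ← two_smul ℝ x, inv_smul_smul₀ two_ne_zero]
  rw [e, add_neg_cancel, smul_zero, norm_zero, norm_neg, Real.zero_rpow hp.ne'] at h
  have h1 : 0 < ‖x‖ ^ p := Real.rpow_pos_of_pos (norm_pos_iff.2 hx) p
  have h2 : 0 < K ^ p := by positivity
  by_contra! hlt
  have h3 : K ^ p < 1 := Real.rpow_lt_one hK.le hlt hp
  have h4 : 1 < 1 / K ^ p := by rwa [lt_div_iff₀ h2, one_mul]
  nlinarith

end Convexity

/-! ### Almost invariant finite sets -/

section Folner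

variable {G : Type*} [Group G]

/-- Right translation by `h` moves at most a fraction `δ` of `Q` out of `Q`. -/
def AlmostInvariant (Q : Finset G) (δ : ℝ) (h : G) : Prop :=
  ∃ E : Finset G, (E.card : ℝ) ≤ δ * Q.card ∧ ∀ x ∈ Q, x ∉ E → x * h ∈ Q

/-- Points outside the exceptional set are carried injectively into `Q`; each of the at most `δ *
Q.card` others costs at most `B`. -/
theorem AlmostInvariant.sum_le {Q : Finset G} {δ : ℝ} {h : G} (hQ : AlmostInvariant Q δ h)
    {φ : G → ℝ} {B : ℝ} (hB : 0 ≤ B) (h0 : ∀ x, 0 ≤ φ x) (h1 : ∀ x ∈ Q, φ (x * h) ≤ B) :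
    ∑ x ∈ Q, φ (x * h) ≤ ∑ x ∈ Q, φ x + δ * Q.card * B := by
  classical
  obtain ⟨E, hE, hQE⟩ := hQ
  rw [← Finset.sum_filter_add_sum_filter_not Q (fun x => x ∉ E)]
  refine add_le_add ?_ ?_
  · have : ∑ x ∈ Q.filter (fun x => x ∉ E), φ (x * h) =
        ∑ y ∈ (Q.filter (fun x => x ∉ E)).image (· * h), φ y := by
      rw [Finset.sum_image fun _ _ _ _ e => mul_right_cancel e]
    rw [this]
    refine Finset.sum_le_sum_of_subset_of_nonneg ?_ fun x _ _ => h0 x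
    intro y hy
    obtain ⟨x, hx, rfl⟩ := Finset.mem_image.1 hy
    rw [Finset.mem_filter] at hx
    exact hQE x hx.1 hx.2
  · calc ∑ x ∈ Q.filter (fun x => ¬ x ∉ E), φ (x * h)
        ≤ ∑ x ∈ Q.filter (fun x => ¬ x ∉ E), B :=
          Finset.sum_le_sum fun x hx => h1 x (Finset.mem_filter.1 hx).1
      _ = (Q.filter (fun x => ¬ x ∉ E)).card * B := by rw [Finset.sum_const, nsmul_eq_mul]
      _ ≤ E.card * B := by
          gcongr
          intro x hx
          rw [Finset.mem_filter, not_not] at hx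
          exact hx.2
      _ ≤ _ := by gcongr

end Folner

/-! ### Approximate affinity along one-parameter subgroups -/

section Direction

/-- The `p`-energy of `F` in the direction `g`. -/
noncomputable def energy {X G : Type*} [NormedAddCommGroup X] [Group G] (F : G → X) (p : ℝ) (Q : Finset G) (g : G) : ℝ :=
  ∑ x ∈ Q, ‖F (x * g) - F x‖ ^ p

variable {X : Type*} [NormedAddCommGroup X] [NormedSpace ℝ X] {p K : ℝ}
variable {G : Type*} [Group G]

/-- The increment of `F` along `g` at `y`, compared with the mean increment along a progression
of length `A` in which this increment is the one of index `i`. -/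
noncomputable def deviation (F : G → X) (A i : ℕ) (g y : G) : X :=
  F (y * g) - F y - (A : ℝ)⁻¹ • (F (y * (g ^ i)⁻¹ * g ^ A) - F (y * (g ^ i)⁻¹))

/-- The increments along `x, x * g, …, x * g ^ A` have mean `(F (x * g ^ A) - F x) / A`, so the
Jensen defect summed over `Q` is a difference of energies once almost invariance replaces `x * g ^
i` by `x`. The index `i` is chosen to do no worse than average. -/
theorem exists_sum_deviation_le (hX : PConvexWith X p K) (hp : 1 ≤ p) (hK : 0 < K)
    (F : G → X) (Q : Finset G) (g : G) {A : ℕ} (hA : 0 < A) {δ B : ℝ} (hB : 0 ≤ B)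
    (hQ : ∀ i < A, AlmostInvariant Q δ (g ^ i))
    (hF : ∀ x ∈ Q, ∀ i < A, ‖F (x * g ^ i * g) - F (x * g ^ i)‖ ^ p ≤ B) :
    ∃ i < A, ∑ x ∈ Q, ‖deviation F A i g (x * g ^ i)‖ ^ p ≤
      (2 * K) ^ p * (energy F p Q g + δ * Q.card * B - energy F p Q (g ^ A) / (A : ℝ) ^ p) := by
  have hA' : (0 : ℝ) < A := by exact_mod_cast hA
  have hne : (Finset.range A).Nonempty := ⟨0, by simpa using hA⟩
  have hc : 0 < (2 * K) ^ p := by positivity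
  suffices h : ∑ i ∈ Finset.range A, ∑ x ∈ Q, ‖deviation F A i g (x * g ^ i)‖ ^ p ≤
      ∑ i ∈ Finset.range A, (2 * K) ^ p *
        (energy F p Q g + δ * Q.card * B - energy F p Q (g ^ A) / (A : ℝ) ^ p) by
    obtain ⟨i, hi, h⟩ := Finset.exists_le_of_sum_le hne h
    exact ⟨i, Finset.mem_range.1 hi, h⟩
  rw [Finset.sum_comm]
  have h1 : ∀ x, ∑ i ∈ Finset.range A, ‖deviation F A i g (x * g ^ i)‖ ^ p ≤
      (2 * K) ^ p * ((∑ i ∈ Finset.range A, ‖F (x * g ^ i * g) - F (x * g ^ i)‖ ^ p) -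
        A * (‖F (x * g ^ A) - F x‖ ^ p / (A : ℝ) ^ p)) := by
    intro x
    have h := hX.sum_deviation_le hp hK hA (fun i => F (x * g ^ i * g) - F (x * g ^ i))
      (u := (A : ℝ)⁻¹ • (F (x * g ^ A) - F x)) (by
        have := Finset.sum_range_sub (fun i => F (x * g ^ i)) A
        simp only [pow_zero, mul_one, pow_succ, ← mul_assoc] at this
        rw [this])
    rw [norm_smul, Real.norm_of_nonneg (by positivity), Real.mul_rpow (by positivity)
      (norm_nonneg _), Real.inv_rpow hA'.le, inv_mul_eq_div] at h
    refine le_trans (le_of_eq ?_) h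
    refine Finset.sum_congr rfl fun i _ => ?_
    simp [deviation]
  refine (Finset.sum_le_sum fun x _ => h1 x).trans ?_
  rw [← Finset.mul_sum, Finset.sum_const, Finset.card_range, nsmul_eq_mul, mul_left_comm,
    Finset.sum_sub_distrib, Finset.sum_comm, ← Finset.mul_sum, ← Finset.sum_div]
  refine mul_le_mul_of_nonneg_left ?_ hc.le
  rw [mul_sub]
  refine sub_le_sub_right ?_ _
  calc _ ≤ ∑ i ∈ Finset.range A, (energy F p Q g + δ * Q.card * B) := by
        refine Finset.sum_le_sum fun i hi => ?_
        exact (hQ i (Finset.mem_range.1 hi)).sum_le (φ := fun y => ‖F (y * g) - F y‖ ^ p) hB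
          (fun x => by positivity) fun x hx => hF x hx i (Finset.mem_range.1 hi)
    _ = _ := by rw [Finset.sum_const, Finset.card_range, nsmul_eq_mul]

end Direction

/-! ### Pigeonholing over scales -/

section Scales

theorem energy_nonneg {X G : Type*} [NormedAddCommGroup X] [Group G] (F : G → X) (p : ℝ) (Q : Finset G) (g : G) : 0 ≤ energy F p Q g :=
  Finset.sum_nonneg fun _ _ => by positivity

variable {X : Type*} [NormedAddCommGroup X] {p K : ℝ} {G : Type*} [Group G]

/-- The energy at scale `A ^ j`, divided by its trivial bound. -/
noncomputable def normEnergy (F : G → X) (p : ℝ) (Q : Finset G) (D : ℝ) (A : ℕ) (g : ℕ → G)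
    (j : ℕ) : ℝ :=
  energy F p Q (g j) / (Q.card * (D * (A : ℝ) ^ j) ^ p)

theorem normEnergy_nonneg (F : G → X) (p : ℝ) (Q : Finset G) {D : ℝ} (hD : 0 < D) (A : ℕ)
    (g : ℕ → G) (j : ℕ) : 0 ≤ normEnergy F p Q D A g j :=
  div_nonneg (energy_nonneg ..) (by positivity)

variable [NormedSpace ℝ X]

theorem exists_sum_deviation_le_normEnergy (hX : PConvexWith X p K) (hp : 1 ≤ p) (hK : 0 < K)
    (F : G → X) {Q : Finset G} (hne : Q.Nonempty) {D : ℝ} (hD : 0 < D) {A : ℕ} (hA : 0 < A)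
    (g : ℕ → G) (hg : ∀ j, g j ^ A = g (j + 1)) {δ : ℝ} {j : ℕ}
    (hQ : ∀ i < A, AlmostInvariant Q δ (g j ^ i))
    (hF : ∀ x ∈ Q, ∀ i < A, ‖F (x * g j ^ i * g j) - F (x * g j ^ i)‖ ≤ D * (A : ℝ) ^ j) :
    ∃ i < A, ∑ x ∈ Q, ‖deviation F A i (g j) (x * g j ^ i)‖ ^ p ≤
      (2 * K) ^ p * (Q.card * (D * (A : ℝ) ^ j) ^ p) *
        (normEnergy F p Q D A g j - normEnergy F p Q D A g (j + 1) + δ) := by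
  have hA' : (0 : ℝ) < A := by exact_mod_cast hA
  have hc : (0 : ℝ) < Q.card := by exact_mod_cast hne.card_pos
  obtain ⟨i, hi, h⟩ := exists_sum_deviation_le hX hp hK F Q (g j) hA
    (B := (D * (A : ℝ) ^ j) ^ p) (by positivity) hQ fun x hx i hi =>
      Real.rpow_le_rpow (norm_nonneg _) (hF x hx i hi) (by linarith)
  refine ⟨i, hi, h.trans_eq ?_⟩
  have e : (D * (A : ℝ) ^ (j + 1)) ^ p = (D * (A : ℝ) ^ j) ^ p * (A : ℝ) ^ p := by
    rw [pow_succ, ← mul_assoc, Real.mul_rpow (by positivity) hA'.le]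
  rw [hg, mul_assoc ((2 * K) ^ p)]
  congr 1
  unfold normEnergy
  rw [e]
  have h1 : 0 < (D * (A : ℝ) ^ j) ^ p := by positivity
  have h2 : 0 < (A : ℝ) ^ p := by positivity
  field_simp
  ring

/-- A single scale must serve both directions, so the two telescoping sums are added before
pigeonholing. -/
theorem exists_scale (hX : PConvexWith X p K) (hp : 1 ≤ p) (hK : 0 < K)
    (F : G → X) {Q : Finset G} (hne : Q.Nonempty) {D : ℝ} (hD : 0 < D) {A N : ℕ} (hA : 0 < A)
    (hN : 0 < N) (g h : ℕ → G) (hg : ∀ j, g j ^ A = g (j + 1)) (hh : ∀ j, h j ^ A = h (j + 1))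
    (hQg : ∀ j < N, ∀ i < A, AlmostInvariant Q (N : ℝ)⁻¹ (g j ^ i))
    (hQh : ∀ j < N, ∀ i < A, AlmostInvariant Q (N : ℝ)⁻¹ (h j ^ i))
    (hFg : ∀ j < N, ∀ x ∈ Q, ∀ i < A,
      ‖F (x * g j ^ i * g j) - F (x * g j ^ i)‖ ≤ D * (A : ℝ) ^ j)
    (hFh : ∀ j < N, ∀ x ∈ Q, ∀ i < A,
      ‖F (x * h j ^ i * h j) - F (x * h j ^ i)‖ ≤ D * (A : ℝ) ^ j) :
    ∃ j < N,
      (∃ i < A, ∑ x ∈ Q, ‖deviation F A i (g j) (x * g j ^ i)‖ ^ p ≤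
        Q.card * (2 * K * (D * (A : ℝ) ^ j)) ^ p * (4 / N)) ∧
      (∃ i < A, ∑ x ∈ Q, ‖deviation F A i (h j) (x * h j ^ i)‖ ^ p ≤
        Q.card * (2 * K * (D * (A : ℝ) ^ j)) ^ p * (4 / N)) := by
  have hA' : (0 : ℝ) < A := by exact_mod_cast hA
  have hN' : (0 : ℝ) < N := by exact_mod_cast hN
  have hc : (0 : ℝ) < Q.card := by exact_mod_cast hne.card_pos
  have key : ∀ f : ℕ → G, (∀ j, f j ^ A = f (j + 1)) →
      (∀ j < N, ∀ i < A, AlmostInvariant Q (N : ℝ)⁻¹ (f j ^ i)) →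
      (∀ j < N, ∀ x ∈ Q, ∀ i < A,
        ‖F (x * f j ^ i * f j) - F (x * f j ^ i)‖ ≤ D * (A : ℝ) ^ j) →
      normEnergy F p Q D A f 0 ≤ 1 ∧ ∀ j < N,
        0 ≤ normEnergy F p Q D A f j - normEnergy F p Q D A f (j + 1) + (N : ℝ)⁻¹ ∧
        (normEnergy F p Q D A f j - normEnergy F p Q D A f (j + 1) + (N : ℝ)⁻¹ ≤ 4 / N →
          ∃ i < A, ∑ x ∈ Q, ‖deviation F A i (f j) (x * f j ^ i)‖ ^ p ≤
            Q.card * (2 * K * (D * (A : ℝ) ^ j)) ^ p * (4 / N)) := by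
    intro f hf hQ hF
    constructor
    · refine div_le_one_of_le₀ ?_ (by positivity)
      rw [energy, ← nsmul_eq_mul]
      refine Finset.sum_le_card_nsmul _ _ _ fun x hx => ?_
      have := hF 0 hN x hx 0 hA
      rw [pow_zero, mul_one] at this
      exact Real.rpow_le_rpow (norm_nonneg _) this (by linarith)
    · intro j hj
      obtain ⟨i, hi, h⟩ := exists_sum_deviation_le_normEnergy hX hp hK F hne hD hA f hf
        (hQ j hj) (hF j hj)
      have hpos : 0 < (2 * K) ^ p * (Q.card * (D * (A : ℝ) ^ j) ^ p) := by positivity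
      refine ⟨?_, fun hle => ⟨i, hi, h.trans ?_⟩⟩
      · have h0 := (Finset.sum_nonneg fun x _ => by positivity :
          (0 : ℝ) ≤ ∑ x ∈ Q, ‖deviation F A i (f j) (x * f j ^ i)‖ ^ p).trans h
        exact nonneg_of_mul_nonneg_right h0 hpos
      · rw [Real.mul_rpow (by positivity) (by positivity : 0 ≤ D * (A : ℝ) ^ j),
          mul_left_comm (Q.card : ℝ)]
        exact mul_le_mul_of_nonneg_left hle hpos.le
  obtain ⟨hg0, hg1⟩ := key g hg hQg hFg
  obtain ⟨hh0, hh1⟩ := key h hh hQh hFh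
  set P := normEnergy F p Q D A g
  set R := normEnergy F p Q D A h
  -- The total 4 is two initial energies, each at most 1, plus two boundary errors, each `N * N⁻¹`.
  have hsum : ∑ j ∈ Finset.range N,
      ((P j - P (j + 1) + (N : ℝ)⁻¹) + (R j - R (j + 1) + (N : ℝ)⁻¹)) ≤
      ∑ j ∈ Finset.range N, (4 / N : ℝ) := by
    simp only [Finset.sum_add_distrib, Finset.sum_range_sub', Finset.sum_const, Finset.card_range,
      nsmul_eq_mul]
    have h1 : (N : ℝ) * (N : ℝ)⁻¹ = 1 := mul_inv_cancel₀ hN'.ne'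
    have h2 : (N : ℝ) * (4 / N) = 4 := mul_div_cancel₀ _ hN'.ne'
    have h3 : 0 ≤ P N := normEnergy_nonneg F p Q hD A g N
    have h4 : 0 ≤ R N := normEnergy_nonneg F p Q hD A h N
    linarith
  obtain ⟨j, hj, hle⟩ := Finset.exists_le_of_sum_le ⟨0, by simpa using hN⟩ hsum
  have hj' := Finset.mem_range.1 hj
  refine ⟨j, hj', (hg1 j hj').2 ?_, (hh1 j hj').2 ?_⟩
  -- Each summand is nonnegative, so a bound on the sum bounds both.
  · linarith [(hh1 j hj').1]
  · linarith [(hg1 j hj').1]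

/-- The index `i` from the pigeonhole is not under control; translating by `k * (g ^ i)⁻¹` moves the
estimate to any prescribed `k`, and the boundary error raises 4 to 5. -/
theorem sum_deviation_translate_le (hp : 0 ≤ p) (hK : 1 ≤ K) (F : G → X) {Q : Finset G} {M : ℝ}
    (hM : 0 ≤ M) {A N i : ℕ} {g : G}
    (hdev : ∑ x ∈ Q, ‖deviation F A i g (x * g ^ i)‖ ^ p ≤ Q.card * (2 * K * M) ^ p * (4 / N))
    {k : G} (hQ : AlmostInvariant Q (N : ℝ)⁻¹ (k * (g ^ i)⁻¹))
    (hF : ∀ x ∈ Q, ‖deviation F A i g (x * k)‖ ≤ 2 * M) :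
    ∑ x ∈ Q, ‖deviation F A i g (x * k)‖ ^ p ≤ Q.card * (2 * K * M) ^ p * (5 / N) := by
  have h := hQ.sum_le (φ := fun x => ‖deviation F A i g (x * g ^ i)‖ ^ p)
    (B := (2 * M) ^ p) (by positivity) (fun x => by positivity) fun x hx => by
      simp only [mul_assoc, inv_mul_cancel, mul_one]
      exact Real.rpow_le_rpow (norm_nonneg _) (hF x hx) hp
  simp only [mul_assoc, inv_mul_cancel, mul_one] at h hdev ⊢
  have h2 : (2 * M) ^ p ≤ (2 * (K * M)) ^ p :=
    Real.rpow_le_rpow (by positivity) (by nlinarith) hp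
  calc _ ≤ _ := h
    _ ≤ Q.card * ((2 * (K * M)) ^ p * (4 / N)) +
        (N : ℝ)⁻¹ * (Q.card * (2 * (K * M)) ^ p) := by gcongr
    _ = _ := by ring

end Scales

/-! ### Boxes -/

namespace Model

/-- The points of `[0, L)` that the translation by `t` moves out of `[0, L)`. -/
noncomputable def exits (L t : ℤ) : Finset ℤ := (Finset.Ico 0 L).filter fun x => x + t ∉ Finset.Ico 0 L

theorem card_exits_le (L t : ℤ) : ((exits L t).card : ℤ) ≤ |t| := by
  have h : exits L t ⊆ Finset.Ico (L - t) L ∪ Finset.Ico 0 (-t) := by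
    intro x hx
    simp only [exits, Finset.mem_filter, Finset.mem_Ico, Finset.mem_union] at hx ⊢
    omega
  have h1 := Finset.card_le_card h
  have h2 := Finset.card_union_le (Finset.Ico (L - t) L) (Finset.Ico 0 (-t))
  rw [Int.card_Ico, Int.card_Ico] at h2
  rcases abs_cases t with ⟨h3, h4⟩ | ⟨h3, h4⟩ <;> omega

/-- The product of `[0, L)`, `[0, L)` and `[0, L ^ 2)`. -/
def box (L : ℤ) : Set Model :=
  {g | g.x ∈ Finset.Ico 0 L ∧ g.y ∈ Finset.Ico 0 L ∧ g.z ∈ Finset.Ico 0 (L ^ 2)}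

theorem mk_injective : Function.Injective fun t : ℤ × ℤ × ℤ => (⟨t.1, t.2.1, t.2.2⟩ : Model) := by
  rintro ⟨a, b, c⟩ ⟨a', b', c'⟩ h
  simpa using h

/-- The box of side `L` as a finite set. -/
noncomputable def boxFinset (L : ℤ) : Finset Model :=
  (Finset.Ico 0 L ×ˢ Finset.Ico 0 L ×ˢ Finset.Ico 0 (L ^ 2)).map ⟨_, mk_injective⟩

theorem mem_boxFinset {L : ℤ} {g : Model} : g ∈ boxFinset L ↔ g ∈ box L := by
  simp only [boxFinset, Finset.mem_map, Finset.mem_product, box, Set.mem_ofPred_eq]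
  constructor
  · rintro ⟨t, ht, rfl⟩; exact ht
  · intro h; exact ⟨(g.x, g.y, g.z), h, rfl⟩

theorem card_boxFinset {L : ℤ} (hL : 0 ≤ L) : ((boxFinset L).card : ℤ) = L ^ 4 := by
  rw [boxFinset, Finset.card_map, Finset.card_product, Finset.card_product]
  simp only [Int.card_Ico, sub_zero, Nat.cast_mul, Int.toNat_of_nonneg hL,
    Int.toNat_of_nonneg (sq_nonneg L)]
  ring

/-- A point leaves through one of three pairs of faces. The `x` and `y` faces lose at most `n * L ^
3` points each. On a fibre over `(x, y)` the `z` coordinate moves by `h.z + x * h.y`, at most `4 * n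
* L`, for a loss of `4 * n * L ^ 3`. The sum is compared with `L ^ 4` points. -/
theorem almostInvariant_boxFinset {L n : ℤ} (hL : 0 < L) {h : Model} (hx : |h.x| ≤ n)
    (hy : |h.y| ≤ n) (hz : |h.z| ≤ 3 * n * L) {δ : ℝ} (hδ : 6 * (n : ℝ) ≤ δ * L) :
    AlmostInvariant (boxFinset L) δ h := by
  classical
  let e : ℤ × ℤ × ℤ → Model := fun t => ⟨t.1, t.2.1, t.2.2⟩
  let I := Finset.Ico 0 L
  let J := Finset.Ico 0 (L ^ 2)
  let E₁ := (exits L h.x ×ˢ I ×ˢ J).image e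
  let E₂ := (I ×ˢ exits L h.y ×ˢ J).image e
  let E₃ := (I ×ˢ I).biUnion fun t =>
    (exits (L ^ 2) (h.z + t.1 * h.y)).image fun z => e (t.1, t.2, z)
  have hI : (I.card : ℤ) = L := by simp [I, hL.le]
  have hJ : (J.card : ℤ) = L ^ 2 := by simp [J, sq_nonneg]
  have hn : 0 ≤ n := (abs_nonneg _).trans hx
  have c1 : (E₁.card : ℤ) ≤ n * L ^ 3 := by
    have h1 : (E₁.card : ℤ) ≤ ((exits L h.x).card * (I.card * J.card) : ℕ) := by
      rw [← Finset.card_product, ← Finset.card_product]; exact_mod_cast Finset.card_image_le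
    rw [Nat.cast_mul, Nat.cast_mul, hI, hJ] at h1
    have := (card_exits_le L h.x).trans hx
    calc _ ≤ _ := h1
      _ ≤ n * (L * L ^ 2) := by gcongr
      _ = _ := by ring
  have c2 : (E₂.card : ℤ) ≤ n * L ^ 3 := by
    have h1 : (E₂.card : ℤ) ≤ (I.card * ((exits L h.y).card * J.card) : ℕ) := by
      rw [← Finset.card_product, ← Finset.card_product]; exact_mod_cast Finset.card_image_le
    rw [Nat.cast_mul, Nat.cast_mul, hI, hJ] at h1
    have := (card_exits_le L h.y).trans hy
    calc _ ≤ _ := h1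
      _ ≤ L * (n * L ^ 2) := by gcongr
      _ = _ := by ring
  have c3 : (E₃.card : ℤ) ≤ 4 * (n * L ^ 3) := by
    have h1 : (E₃.card : ℤ) ≤ ∑ t ∈ I ×ˢ I, (4 * (n * L)) := by
      refine (Nat.cast_le.2 Finset.card_biUnion_le).trans ?_
      rw [Nat.cast_sum]
      refine Finset.sum_le_sum fun t ht => ?_
      refine (Nat.cast_le.2 Finset.card_image_le).trans ((card_exits_le _ _).trans ?_)
      have ht1 := Finset.mem_Ico.1 (Finset.mem_product.1 ht).1
      have h2 : |t.1 * h.y| ≤ L * n := by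
        rw [abs_mul, abs_of_nonneg ht1.1]
        exact mul_le_mul ht1.2.le hy (abs_nonneg _) hL.le
      have := abs_add_le h.z (t.1 * h.y)
      linarith
    rw [Finset.sum_const, Finset.card_product, nsmul_eq_mul, Nat.cast_mul, hI] at h1
    calc _ ≤ _ := h1
      _ = _ := by ring
  refine ⟨E₁ ∪ E₂ ∪ E₃, ?_, ?_⟩
  · have h1 : ((E₁ ∪ E₂ ∪ E₃).card : ℤ) ≤ 6 * n * L ^ 3 := by
      have := Finset.card_union_le (E₁ ∪ E₂) E₃
      have := Finset.card_union_le E₁ E₂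
      have : 6 * n * L ^ 3 = n * L ^ 3 + n * L ^ 3 + 4 * (n * L ^ 3) := by ring
      omega
    have h2 : ((E₁ ∪ E₂ ∪ E₃).card : ℝ) ≤ 6 * n * (L : ℝ) ^ 3 := by exact_mod_cast h1
    have h3 : ((boxFinset L).card : ℝ) = (L : ℝ) ^ 4 := by exact_mod_cast card_boxFinset hL.le
    have hL' : (0 : ℝ) < L := by exact_mod_cast hL
    rw [h3]
    calc _ ≤ _ := h2
      _ ≤ δ * L * (L : ℝ) ^ 3 := by gcongr
      _ = _ := by ring
  · intro g hg hgE
    rw [mem_boxFinset] at hg ⊢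
    obtain ⟨g1, g2, g3⟩ := hg
    simp only [Finset.mem_union, not_or] at hgE
    obtain ⟨⟨hE1, hE2⟩, hE3⟩ := hgE
    refine ⟨?_, ?_, ?_⟩
    · by_contra hc
      refine hE1 (Finset.mem_image.2 ⟨(g.x, g.y, g.z), ?_, rfl⟩)
      exact Finset.mem_product.2 ⟨Finset.mem_filter.2 ⟨g1, hc⟩, Finset.mem_product.2 ⟨g2, g3⟩⟩
    · by_contra hc
      refine hE2 (Finset.mem_image.2 ⟨(g.x, g.y, g.z), ?_, rfl⟩)
      exact Finset.mem_product.2 ⟨g1, Finset.mem_product.2 ⟨Finset.mem_filter.2 ⟨g2, hc⟩, g3⟩⟩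
    · by_contra hc
      refine hE3 (Finset.mem_biUnion.2 ⟨(g.x, g.y), Finset.mem_product.2 ⟨g1, g2⟩, ?_⟩)
      refine Finset.mem_image.2 ⟨g.z, Finset.mem_filter.2 ⟨g3, ?_⟩, rfl⟩
      rwa [mul_z, add_assoc] at hc

end Model

namespace Model

/-! ### Comparison at a single scale -/

/-- The point `a ^ t`. -/
def hor (t : ℤ) : Model := ⟨t, 0, 0⟩

/-- The point `b ^ t`. -/
def ver (t : ℤ) : Model := ⟨0, t, 0⟩

theorem hor_pow (t : ℤ) (n : ℕ) : hor t ^ n = hor (n * t) := by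
  rw [pow_of_y_eq_zero rfl]; ext <;> simp [hor]

theorem ver_pow (t : ℤ) (n : ℕ) : ver t ^ n = ver (n * t) := by
  rw [pow_of_x_eq_zero rfl]; ext <;> simp [ver]

theorem inv_hor (t : ℤ) : (hor t)⁻¹ = hor (-t) := by ext <;> simp [hor]

theorem inv_ver (t : ℤ) : (ver t)⁻¹ = ver (-t) := by ext <;> simp [ver]

theorem wordLength_hor_le (t : ℤ) : (wordLength (toHeis (hor t)) : ℝ) ≤ |(t : ℝ)| := by
  have h : (wordLength (toHeis (hor t)) : ℤ) ≤ |t| := by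
    rw [← Int.natCast_natAbs]
    exact_mod_cast (by simpa [toHeis_apply, hor] using wordLength_zpow_le genA_mem_genSet t)
  exact_mod_cast h

theorem wordLength_ver_le (t : ℤ) : (wordLength (toHeis (ver t)) : ℝ) ≤ |(t : ℝ)| := by
  have h : (wordLength (toHeis (ver t)) : ℤ) ≤ |t| := by
    rw [← Int.natCast_natAbs]
    exact_mod_cast (by simpa [toHeis_apply, ver] using wordLength_zpow_le genB_mem_genSet t)
  exact_mod_cast h

/-- The symmetric box of size `L`. -/
def IsSmall (L : ℤ) (g : Model) : Prop := |g.x| ≤ L ∧ |g.y| ≤ L ∧ |g.z| ≤ L ^ 2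

theorem isSmall_of_le {L n : ℤ} (hn : 0 ≤ n) (hL : 6 * n ≤ L) {g : Model} (hx : |g.x| ≤ 2 * n)
    (hy : |g.y| ≤ 2 * n) (hz : |g.z| ≤ 2 * n ^ 2) : IsSmall L g :=
  ⟨by linarith, by linarith, by nlinarith⟩

variable {X : Type*} [NormedAddCommGroup X]

/-- `F` is `D`-Lipschitz near the box of side `L`. -/
def LipschitzNear (F : Model → X) (L : ℤ) (D : ℝ) : Prop :=
  ∀ x ∈ boxFinset L, ∀ u v, IsSmall L u → IsSmall L v →
    ‖F (x * u) - F (x * v)‖ ≤ D * wordLength (toHeis (u⁻¹ * v))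

theorem norm_deviation_le [NormedSpace ℝ X] {F : Model → X} {L : ℤ} {D : ℝ} (hD : 0 ≤ D)
    (hF : LipschitzNear F L D) {A i : ℕ} (hA : 0 < A) {g k x : Model} (hx : x ∈ boxFinset L)
    {m : ℝ} (h1 : IsSmall L k) (h2 : IsSmall L (k * g)) (h3 : IsSmall L (k * (g ^ i)⁻¹))
    (h4 : IsSmall L (k * (g ^ i)⁻¹ * g ^ A)) (hg : wordLength (toHeis g) ≤ m)
    (hgA : wordLength (toHeis (g ^ A)) ≤ A * m) :
    ‖deviation F A i g (x * k)‖ ≤ 2 * (D * m) := by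
  have hA' : (0 : ℝ) < A := by exact_mod_cast hA
  have e1 : ‖F (x * k * g) - F (x * k)‖ ≤ D * m := by
    rw [norm_sub_rev, mul_assoc]
    refine (hF x hx _ _ h1 h2).trans ?_
    rw [inv_mul_cancel_left]
    gcongr
  have e2 : ‖F (x * k * (g ^ i)⁻¹ * g ^ A) - F (x * k * (g ^ i)⁻¹)‖ ≤ D * (A * m) := by
    rw [norm_sub_rev, mul_assoc x k, mul_assoc x]
    refine (hF x hx _ _ h3 h4).trans ?_
    rw [inv_mul_cancel_left]
    gcongr
  calc _ ≤ ‖F (x * k * g) - F (x * k)‖ +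
        ‖(A : ℝ)⁻¹ • (F (x * k * (g ^ i)⁻¹ * g ^ A) - F (x * k * (g ^ i)⁻¹))‖ := norm_sub_le _ _
    _ ≤ D * m + (A : ℝ)⁻¹ * (D * (A * m)) := by
        rw [norm_smul, Real.norm_of_nonneg (by positivity)]
        gcongr
    _ = _ := by field_simp; ring

/-- Each increment is replaced by the mean along its progression; the means depend only on
endpoints, which are `r`-close, and division by `A` makes their difference small. -/
theorem norm_increment_sub_le [NormedSpace ℝ X] {F : Model → X} {L : ℤ} {D : ℝ} (hD : 0 ≤ D)
    (hF : LipschitzNear F L D) {A i : ℕ} {g k l x : Model} (hx : x ∈ boxFinset L)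
    {r : ℝ} (h1 : IsSmall L (k * (g ^ i)⁻¹)) (h2 : IsSmall L (k * (g ^ i)⁻¹ * g ^ A))
    (h3 : IsSmall L (l * (g ^ i)⁻¹)) (h4 : IsSmall L (l * (g ^ i)⁻¹ * g ^ A))
    (h5 : wordLength (toHeis ((k * (g ^ i)⁻¹)⁻¹ * (l * (g ^ i)⁻¹))) ≤ r)
    (h6 : wordLength (toHeis ((k * (g ^ i)⁻¹ * g ^ A)⁻¹ * (l * (g ^ i)⁻¹ * g ^ A))) ≤ r) :
    ‖(F (x * k * g) - F (x * k)) - (F (x * l * g) - F (x * l))‖ ≤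
      ‖deviation F A i g (x * k)‖ + ‖deviation F A i g (x * l)‖ +
        (A : ℝ)⁻¹ * (2 * (D * r)) := by
  have e1 := (hF x hx _ _ h1 h3).trans (mul_le_mul_of_nonneg_left h5 hD)
  have e2 := (hF x hx _ _ h2 h4).trans (mul_le_mul_of_nonneg_left h6 hD)
  simp only [← mul_assoc] at e1 e2
  have e : (F (x * k * g) - F (x * k)) - (F (x * l * g) - F (x * l)) =
      deviation F A i g (x * k) - deviation F A i g (x * l) +
      (A : ℝ)⁻¹ • ((F (x * k * (g ^ i)⁻¹ * g ^ A) - F (x * l * (g ^ i)⁻¹ * g ^ A)) -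
        (F (x * k * (g ^ i)⁻¹) - F (x * l * (g ^ i)⁻¹))) := by
    simp only [deviation, smul_sub]
    abel
  rw [e]
  refine (norm_add_le _ _).trans (add_le_add (norm_sub_le _ _) ?_)
  rw [norm_smul, Real.norm_of_nonneg (by positivity)]
  gcongr
  exact (norm_sub_le _ _).trans (by linarith)

set_option maxHeartbeats 1000000 in
/-- A map that is almost affine at scale `m` along both generators has large distortion. -/
theorem single_scale [NormedSpace ℝ X] {F : Model → X} {p K D : ℝ} (hp : 1 ≤ p) (hK : 1 ≤ K)
    (hD : 0 < D) {B N m : ℕ} (hB : 0 < B) (hN : 0 < N) (hm : 0 < m) {L : ℤ}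
    (hL : 6 * ((B : ℤ) ^ 2 * m) ≤ L) (hLN : 6 * ((B : ℝ) ^ 2 * m) ≤ (N : ℝ)⁻¹ * L)
    (hF : LipschitzNear F L D)
    (hlow : ∀ x ∈ boxFinset L, ∀ v, IsSmall L v → (wordLength (toHeis v) : ℝ) ≤ ‖F (x * v) - F x‖)
    {i i' : ℕ} (hi : i < B ^ 2) (hi' : i' < B ^ 2)
    (hdev : ∑ x ∈ boxFinset L, ‖deviation F (B ^ 2) i (hor m) (x * hor m ^ i)‖ ^ p ≤
      (boxFinset L).card * (2 * K * (D * m)) ^ p * (4 / N))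
    (hdev' : ∑ x ∈ boxFinset L, ‖deviation F (B ^ 2) i' (ver m) (x * ver m ^ i')‖ ^ p ≤
      (boxFinset L).card * (2 * K * (D * m)) ^ p * (4 / N)) :
    1 ≤ D * (160 * K / (N : ℝ) ^ (1 / p) + 48 / B) := by
  have hA : 0 < B ^ 2 := by positivity
  have hK0 : 0 < K := by linarith
  have hmR : (0 : ℝ) < m := by exact_mod_cast hm
  have hNR : (0 : ℝ) < N := by exact_mod_cast hN
  have hBR : (0 : ℝ) < B := by exact_mod_cast hB
  have hmZ : (1 : ℤ) ≤ m := by exact_mod_cast hm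
  have hBZ : (1 : ℤ) ≤ B := by exact_mod_cast hB
  -- the integers `n = A m`, `s = i m` and `s' = i' m`
  obtain ⟨n, hn⟩ : ∃ n : ℤ, n = (B : ℤ) ^ 2 * m := ⟨_, rfl⟩
  obtain ⟨s, hs⟩ : ∃ s : ℤ, s = i * m := ⟨_, rfl⟩
  obtain ⟨s', hs'⟩ : ∃ s' : ℤ, s' = i' * m := ⟨_, rfl⟩
  have hs0 : 0 ≤ s := by rw [hs]; positivity
  have hs0' : 0 ≤ s' := by rw [hs']; positivity
  have hsn : s ≤ n := by
    rw [hs, hn]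
    gcongr
    exact_mod_cast hi.le
  have hsn' : s' ≤ n := by
    rw [hs', hn]
    gcongr
    exact_mod_cast hi'.le
  have hmn : (m : ℤ) ≤ n := by rw [hn]; nlinarith [one_le_pow₀ hBZ (n := 2)]
  rw [← hn] at hL
  have hLN' : 6 * (n : ℝ) ≤ (N : ℝ)⁻¹ * L := by rw [hn]; push_cast; exact hLN
  have hn0 : 0 ≤ n := by omega
  have hL0 : 0 < L := by omega
  have pa : hor m ^ i = hor s := by rw [hor_pow, hs]
  have pA : hor m ^ (B ^ 2) = hor n := by rw [hor_pow, hn]; push_cast; rfl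
  have pb : ver m ^ i' = ver s' := by rw [ver_pow, hs']
  have pB : ver m ^ (B ^ 2) = ver n := by rw [ver_pow, hn]; push_cast; rfl
  have hmn2 : (m : ℤ) ^ 2 ≤ n ^ 2 := pow_le_pow_left₀ (by omega) hmn 2
  have hmm : (m : ℤ) * n ≤ n ^ 2 := by nlinarith
  have hms' : (m : ℤ) * s' ≤ m * n := by gcongr
  have hms : (m : ℤ) * s ≤ m * n := by gcongr
  have hms0 : 0 ≤ (m : ℤ) * s := by positivity
  have hms0' : 0 ≤ (m : ℤ) * s' := by positivity
  have hm2 : 0 ≤ (m : ℤ) ^ 2 := by positivity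
  have hm2n : (m : ℤ) ^ 2 ≤ m * n := by nlinarith
  have hnL : n ^ 2 ≤ n * L := by nlinarith
  -- The parallelogram has sides `1 → a ^ m → a ^ m * b ^ m` and `k₂ → k₁ → k₁ * a ^ m`, with `k₂ *
  -- b ^ m = k₁` and `k₁ * a ^ m = a ^ m * b ^ m`. Its gap is `k₂ = c ^ (m ^ 2)`.
  let k₁ : Model := ⟨0, m, (m : ℤ) ^ 2⟩
  let k₂ : Model := ⟨0, 0, (m : ℤ) ^ 2⟩
  have small {g : Model} (hx : |g.x| ≤ 2 * n) (hy : |g.y| ≤ 2 * n) (hz : |g.z| ≤ 2 * n ^ 2) :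
    IsSmall L g := isSmall_of_le hn0 hL hx hy hz
  have inv {g : Model} (hx : |g.x| ≤ n) (hy : |g.y| ≤ n) (hz : |g.z| ≤ n ^ 2) :
      AlmostInvariant (boxFinset L) (N : ℝ)⁻¹ g :=
    almostInvariant_boxFinset hL0 hx hy (by nlinarith) hLN'
  have la : (wordLength (toHeis (hor m)) : ℝ) ≤ m := by simpa using wordLength_hor_le m
  have lb : (wordLength (toHeis (ver m)) : ℝ) ≤ m := by simpa using wordLength_ver_le m
  have lA : (wordLength (toHeis (hor m ^ (B ^ 2))) : ℝ) ≤ (B ^ 2 : ℕ) * m := by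
    rw [hor_pow]
    refine (wordLength_hor_le _).trans_eq ?_
    push_cast
    rw [abs_of_nonneg (by positivity)]
  have lB : (wordLength (toHeis (ver m ^ (B ^ 2))) : ℝ) ≤ (B ^ 2 : ℕ) * m := by
    rw [ver_pow]
    refine (wordLength_ver_le _).trans_eq ?_
    push_cast
    rw [abs_of_nonneg (by positivity)]
  have sa1 : IsSmall L (1 * (hor m ^ i)⁻¹) := by
    rw [pa, inv_hor, one_mul]
    apply small <;> simp only [hor, abs_le] <;> constructor <;> linarith
  have sa2 : IsSmall L (1 * (hor m ^ i)⁻¹ * hor m ^ (B ^ 2)) := by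
    rw [pa, pA, inv_hor, one_mul]
    apply small <;> simp only [hor, mul_x, mul_y, mul_z, abs_le] <;> constructor <;> linarith
  have sa3 : IsSmall L (k₁ * (hor m ^ i)⁻¹) := by
    rw [pa, inv_hor]
    apply small <;> simp only [hor, k₁, mul_x, mul_y, mul_z, abs_le] <;> constructor <;> linarith
  have sa4 : IsSmall L (k₁ * (hor m ^ i)⁻¹ * hor m ^ (B ^ 2)) := by
    rw [pa, pA, inv_hor]
    apply small <;> simp only [hor, k₁, mul_x, mul_y, mul_z, abs_le] <;> constructor <;> linarith
  have sb1 : IsSmall L (hor m * (ver m ^ i')⁻¹) := by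
    rw [pb, inv_ver]
    apply small <;> simp only [hor, ver, mul_x, mul_y, mul_z] <;> rw [abs_le] <;>
      constructor <;> linarith
  have sb2 : IsSmall L (hor m * (ver m ^ i')⁻¹ * ver m ^ (B ^ 2)) := by
    rw [pb, pB, inv_ver]
    apply small <;> simp only [hor, ver, mul_x, mul_y, mul_z] <;> rw [abs_le] <;>
      constructor <;> linarith
  have sb3 : IsSmall L (k₂ * (ver m ^ i')⁻¹) := by
    rw [pb, inv_ver]
    apply small <;> simp only [k₂, ver, mul_x, mul_y, mul_z] <;> rw [abs_le] <;>
      constructor <;> linarith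
  have sb4 : IsSmall L (k₂ * (ver m ^ i')⁻¹ * ver m ^ (B ^ 2)) := by
    rw [pb, pB, inv_ver]
    apply small <;> simp only [k₂, ver, mul_x, mul_y, mul_z] <;> rw [abs_le] <;>
      constructor <;> linarith
  have small' {g : Model} (hx : |g.x| ≤ m) (hy : |g.y| ≤ m) (hz : |g.z| ≤ (m : ℤ) ^ 2) :
    IsSmall L g := small (by linarith) (by linarith) (by linarith)
  have s1 : IsSmall L 1 := small' (by simp) (by simp) (by simp)
  have sg : IsSmall L (1 * hor m) := small' (by simp [hor]) (by simp [hor]) (by simp [hor])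
  have sg' : IsSmall L (hor m) := small' (by simp [hor]) (by simp [hor]) (by simp [hor])
  have sk₁ : IsSmall L k₁ := small' (by simp [k₁]) (by simp [k₁]) (by simp [k₁])
  have sk₂ : IsSmall L k₂ := small' (by simp [k₂]) (by simp [k₂]) (by simp [k₂])
  have sk₁g : IsSmall L (k₁ * hor m) :=
    small' (by simp [k₁, hor]) (by simp [k₁, hor]) (by simp [k₁, hor])
  have sk₂g : IsSmall L (k₂ * ver m) :=
    small' (by simp [k₂, ver]) (by simp [k₂, ver]) (by simp [k₂, ver])
  have sgg : IsSmall L (hor m * ver m) :=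
    small' (by simp [ver, hor]) (by simp [ver, hor]) (by simp [ver, hor, sq])
  have hM : 0 ≤ D * m := by positivity
  have t1 := sum_deviation_translate_le (by linarith) hK F hM hdev (k := 1)
    (by rw [pa, inv_hor]
        apply inv <;> simp only [one_mul, hor, abs_le] <;>
          constructor <;> linarith)
    fun x hx => norm_deviation_le hD.le hF hA hx s1 sg sa1 sa2 la lA
  have t2 := sum_deviation_translate_le (by linarith) hK F hM hdev (k := k₁)
    (by rw [pa, inv_hor]
        apply inv <;> simp only [k₁, hor, mul_x, mul_y, mul_z, abs_le] <;>
          constructor <;> linarith)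
    fun x hx => norm_deviation_le hD.le hF hA hx sk₁ sk₁g sa3 sa4 la lA
  have t3 := sum_deviation_translate_le (by linarith) hK F hM hdev' (k := hor m)
    (by rw [pb, inv_ver]
        apply inv <;> simp only [ver, hor, mul_x, mul_y, mul_z, abs_le] <;>
          constructor <;> linarith)
    fun x hx => norm_deviation_le hD.le hF hA hx sg' sgg sb1 sb2 lb lB
  have t4 := sum_deviation_translate_le (by linarith) hK F hM hdev' (k := k₂)
    (by rw [pb, inv_ver]
        apply inv <;> simp only [k₂, ver, mul_x, mul_y, mul_z, abs_le] <;>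
          constructor <;> linarith)
    fun x hx => norm_deviation_le hD.le hF hA hx sk₂ sk₂g sb3 sb4 lb lB
  have hne : (boxFinset L).Nonempty := by
    rw [← Finset.card_pos]
    have := card_boxFinset hL0.le
    have : 0 < L ^ 4 := by positivity
    omega
  -- One base point `y` is good for all four increments at once, whence `20 = 4 * 5`.
  obtain ⟨y, hy, hle⟩ := Finset.exists_le_of_sum_le hne
    (f := fun x => ‖deviation F (B ^ 2) i (hor m) (x * 1)‖ ^ p +
      ‖deviation F (B ^ 2) i (hor m) (x * k₁)‖ ^ p +
      ‖deviation F (B ^ 2) i' (ver m) (x * hor m)‖ ^ p +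
      ‖deviation F (B ^ 2) i' (ver m) (x * k₂)‖ ^ p)
    (g := fun _ => (2 * K * (D * m)) ^ p * (20 / N)) (by
      simp only [Finset.sum_add_distrib, Finset.sum_const, nsmul_eq_mul]
      have : (boxFinset L).card * ((2 * K * (D * m)) ^ p * (20 / N)) =
        4 * ((boxFinset L).card * (2 * K * (D * m)) ^ p * (5 / N)) := by ring
      linarith)
  have root (v : X) (hv : ‖v‖ ^ p ≤ (2 * K * (D * m)) ^ p * (20 / N)) :
      ‖v‖ ≤ 40 * K * (D * m) / (N : ℝ) ^ (1 / p) := by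
    refine (Real.rpow_le_rpow_iff (norm_nonneg _) (by positivity) (by linarith : 0 < p)).1
      (hv.trans ?_)
    rw [Real.div_rpow (by positivity) (by positivity), ← Real.rpow_mul hNR.le,
      one_div_mul_cancel (by linarith), Real.rpow_one, ← mul_div_assoc]
    gcongr
    rw [show 40 * K * (D * m) = 2 * K * (D * m) * 20 by ring,
      Real.mul_rpow (x := 2 * K * (D * m)) (by positivity) (by norm_num)]
    gcongr
    exact Real.self_le_rpow_of_one_le (by norm_num) hp
  have pos (v : X) : 0 ≤ ‖v‖ ^ p := by positivity
  have r1 := root (deviation F (B ^ 2) i (hor m) (y * 1)) (by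
    linarith [pos (deviation F (B ^ 2) i (hor m) (y * k₁)),
      pos (deviation F (B ^ 2) i' (ver m) (y * hor m)),
      pos (deviation F (B ^ 2) i' (ver m) (y * k₂))])
  have r2 := root (deviation F (B ^ 2) i (hor m) (y * k₁)) (by
    linarith [pos (deviation F (B ^ 2) i (hor m) (y * 1)),
      pos (deviation F (B ^ 2) i' (ver m) (y * hor m)),
      pos (deviation F (B ^ 2) i' (ver m) (y * k₂))])
  have r3 := root (deviation F (B ^ 2) i' (ver m) (y * hor m)) (by
    linarith [pos (deviation F (B ^ 2) i (hor m) (y * k₁)),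
      pos (deviation F (B ^ 2) i (hor m) (y * 1)),
      pos (deviation F (B ^ 2) i' (ver m) (y * k₂))])
  have r4 := root (deviation F (B ^ 2) i' (ver m) (y * k₂)) (by
    linarith [pos (deviation F (B ^ 2) i (hor m) (y * k₁)),
      pos (deviation F (B ^ 2) i (hor m) (y * 1)),
      pos (deviation F (B ^ 2) i' (ver m) (y * hor m))])
  have hBm : (1 : ℤ) ≤ B * m := by nlinarith
  have hmB : (m : ℤ) ≤ B * m := by nlinarith
  have hmB2 : (m : ℤ) ^ 2 ≤ (B * m) ^ 2 := pow_le_pow_left₀ (by omega) hmB 2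
  have hnm : (m : ℤ) * n = (B * m) ^ 2 := by rw [hn]; ring
  -- Conjugating by a progression of length at most `n` creates a central part of size at most `2 *
  -- m * n = 2 * (B * m) ^ 2`, hence length at most `(8 + 2 * 2) * (B * m)`.
  have short {g : Model} (hx : |g.x| ≤ m) (hy : |g.y| ≤ m) (hz : |g.z| ≤ 2 * (m * n)) :
      (wordLength (toHeis g) : ℝ) ≤ 12 * (B * m) := by
    have h := wordLength_toHeis_le g hBm (C := 2) (hx.trans hmB) (hy.trans hmB)
      (hz.trans_eq (by rw [hnm]))
    push_cast at h
    linarith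
  have d1 := norm_increment_sub_le hD.le hF hy (r := 12 * (B * m)) sa1 sa2 sa3 sa4
    (by rw [pa, inv_hor]
        apply short <;> simp only [k₁, hor, one_mul, mul_x, mul_y, mul_z, inv_x, inv_y, inv_z,
          abs_le] <;> constructor <;> linarith)
    (by rw [pa, pA, inv_hor]
        apply short <;> simp only [k₁, hor, one_mul, mul_x, mul_y, mul_z, inv_x, inv_y, inv_z,
          abs_le] <;> constructor <;> linarith)
  have d2 := norm_increment_sub_le hD.le hF hy (r := 12 * (B * m)) sb1 sb2 sb3 sb4
    (by rw [pb, inv_ver]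
        apply short <;> simp only [k₂, hor, ver, mul_x, mul_y, mul_z, inv_x, inv_y, inv_z,
          abs_le] <;> constructor <;> linarith)
    (by rw [pb, pB, inv_ver]
        apply short <;> simp only [k₂, hor, ver, mul_x, mul_y, mul_z, inv_x, inv_y, inv_z,
          abs_le] <;> constructor <;> linarith)
  have low : (m : ℝ) ≤ ‖F (y * k₂) - F y‖ :=
    (Nat.cast_le.2 (le_wordLength_center m)).trans (hlow y hy k₂ sk₂)
  have path1 : k₁ * hor m = hor m * ver m := by ext <;> simp [k₁, hor, ver, sq]
  have path2 : k₂ * ver m = k₁ := by ext <;> simp [k₁, k₂, ver]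
  rw [mul_one, mul_assoc y k₁, path1, ← mul_assoc] at d1
  rw [mul_assoc y k₂, path2] at d2
  have tele : F (y * k₂) - F y =
      ((F (y * hor m) - F y) - (F (y * hor m * ver m) - F (y * k₁))) +
      ((F (y * hor m * ver m) - F (y * hor m)) - (F (y * k₁) - F (y * k₂))) := by abel
  have total := (tele ▸ low).trans (norm_add_le _ _)
  rw [mul_one] at r1
  have e : ((B ^ 2 : ℕ) : ℝ)⁻¹ * (2 * (D * (12 * (B * m)))) = 24 * D * m / B := by
    push_cast; field_simp; norm_num
  rw [e] at d1 d2
  have fin : 1 * (m : ℝ) ≤ D * (160 * K / (N : ℝ) ^ (1 / p) + 48 / B) * m := by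
    calc 1 * (m : ℝ) ≤ 4 * (40 * K * (D * m) / (N : ℝ) ^ (1 / p)) + 2 * (24 * D * m / B) := by
          linarith
      _ = _ := by ring
  exact le_of_mul_le_mul_right fin hmR

end Model

/-! ### From embeddings of balls to a bound on the distortion -/

section Embedding

variable {X : Type*} [NormedAddCommGroup X] [NormedSpace ℝ X] {p K : ℝ}

open Model in
theorem one_le_of_bilipschitz (hX : PConvexWith X p K) (hp : 1 ≤ p) (hK : 1 ≤ K) {D : ℝ}
    (hD : 0 < D) {B N : ℕ} (hB : 0 < B) (hN : 0 < N) {R : ℝ}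
    (hR : 240 * (N * ((B : ℝ) ^ 2) ^ N) ≤ R) {f : ball R → X}
    (hf : ∀ x y : ball R,
      (wordDist x y : ℝ) ≤ ‖f x - f y‖ ∧ ‖f x - f y‖ ≤ D * (wordDist x y : ℝ)) :
    1 ≤ D * (160 * K / (N : ℝ) ^ (1 / p) + 48 / B) := by
  classical
  have hBZ : (1 : ℤ) ≤ B := by exact_mod_cast hB
  have hNZ : (1 : ℤ) ≤ N := by exact_mod_cast hN
  have hNR : (0 : ℝ) < N := by exact_mod_cast hN
  have hB2 : (1 : ℤ) ≤ (B : ℤ) ^ 2 := one_le_pow₀ hBZ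
  -- The largest displacement is `B ^ 2 * m ≤ (B ^ 2) ^ N`; this side makes the boundary loss at
  -- most `1 / N` at every scale.
  obtain ⟨L, hL⟩ : ∃ L : ℤ, L = 6 * (N * ((B : ℤ) ^ 2) ^ N) := ⟨_, rfl⟩
  have hL1 : 1 ≤ L := by
    rw [hL]
    nlinarith [one_le_pow₀ hB2 (n := N)]
  have hLR : 40 * (L : ℝ) ≤ R := by
    rw [hL]; push_cast; linarith
  -- The value 0 off the ball is immaterial: every point used is `x * u` with `x` in the box and `u`
  -- small, of length at most `10 * L + 10 * L ≤ R`.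
  let F : Model → X := fun g => if h : toHeis g ∈ ball R then f ⟨toHeis g, h⟩ else 0
  have mem : ∀ x ∈ boxFinset L, ∀ u, IsSmall L u → toHeis (x * u) ∈ ball R := by
    intro x hx u hu
    obtain ⟨h1, h2, h3⟩ := mem_boxFinset.1 hx
    rw [Finset.mem_Ico] at h1 h2 h3
    have e1 := wordLength_toHeis_le x hL1 (C := 1)
      (by rw [abs_of_nonneg h1.1]; exact h1.2.le) (by rw [abs_of_nonneg h2.1]; exact h2.2.le)
      (by rw [abs_of_nonneg h3.1, one_mul]; exact h3.2.le)
    have e2 := wordLength_toHeis_le u hL1 (C := 1) hu.1 hu.2.1 (by rw [one_mul]; exact hu.2.2)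
    have e3 : (wordLength (toHeis x * toHeis u) : ℝ) ≤ _ :=
      Nat.cast_le.2 (wordLength_mul_le (toHeis x) (toHeis u))
    push_cast at e1 e2 e3
    have hL0 : (0 : ℝ) < L := by exact_mod_cast hL1
    simp only [ball, wordDist, inv_one, one_mul, Set.mem_ofPred_eq, map_mul]
    linarith
  have hF : ∀ x ∈ boxFinset L, ∀ u v, IsSmall L u → IsSmall L v →
      (wordLength (toHeis (u⁻¹ * v)) : ℝ) ≤ ‖F (x * u) - F (x * v)‖ ∧
      ‖F (x * u) - F (x * v)‖ ≤ D * wordLength (toHeis (u⁻¹ * v)) := by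
    intro x hx u v hu hv
    have h := hf ⟨_, mem x hx u hu⟩ ⟨_, mem x hx v hv⟩
    have e : (toHeis (x * u))⁻¹ * toHeis (x * v) = toHeis (u⁻¹ * v) := by
      rw [← map_inv, ← map_mul]; congr 1; group
    simp only [F, dif_pos (mem x hx u hu), dif_pos (mem x hx v hv)]
    rwa [wordDist, e] at h
  have hne : (boxFinset L).Nonempty := by
    rw [← Finset.card_pos]
    have := card_boxFinset (by omega : 0 ≤ L)
    have : 0 < L ^ 4 := by positivity
    omega
  have bound (j : ℕ) (hj : j < N) :
      (B : ℤ) ^ 2 * ((B ^ 2) ^ j : ℕ) ≤ ((B : ℤ) ^ 2) ^ N := by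
    push_cast
    rw [← pow_succ']
    exact pow_le_pow_right₀ hB2 hj
  have boundL (j : ℕ) (hj : j < N) : 6 * ((B : ℤ) ^ 2 * ((B ^ 2) ^ j : ℕ)) ≤ L := by
    rw [hL]
    have := bound j hj
    nlinarith [one_le_pow₀ hB2 (n := N)]
  have boundR (j : ℕ) (hj : j < N) :
      6 * ((B : ℝ) ^ 2 * ((B ^ 2) ^ j : ℕ)) ≤ (N : ℝ)⁻¹ * L := by
    have h : (B : ℝ) ^ 2 * ((B ^ 2) ^ j : ℕ) ≤ ((B : ℝ) ^ 2) ^ N := by exact_mod_cast bound j hj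
    rw [hL]
    push_cast
    rw [mul_left_comm (N : ℝ)⁻¹, inv_mul_cancel_left₀ hNR.ne']
    push_cast at h
    linarith
  have idx (j i : ℕ) (hj : j < N) (hi : i ≤ B ^ 2) :
      (i : ℤ) * ((B ^ 2) ^ j : ℕ) ≤ (B : ℤ) ^ 2 * ((B ^ 2) ^ j : ℕ) := by
    gcongr
    exact_mod_cast hi
  have smallh (j i : ℕ) (hj : j < N) (hi : i ≤ B ^ 2) :
      IsSmall L (hor ((B ^ 2) ^ j : ℕ) ^ i) := by
    rw [hor_pow]
    refine isSmall_of_le (by positivity) (boundL j hj) ?_ ?_ ?_ <;> simp only [hor, abs_zero]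
    · rw [abs_of_nonneg (by positivity)]
      have := idx j i hj hi
      have : 0 ≤ (B : ℤ) ^ 2 * ((B ^ 2) ^ j : ℕ) := by positivity
      linarith
    all_goals positivity
  have smallv (j i : ℕ) (hj : j < N) (hi : i ≤ B ^ 2) :
      IsSmall L (ver ((B ^ 2) ^ j : ℕ) ^ i) := by
    rw [ver_pow]
    refine isSmall_of_le (by positivity) (boundL j hj) ?_ ?_ ?_ <;> simp only [ver, abs_zero]
    · positivity
    · rw [abs_of_nonneg (by positivity)]
      have := idx j i hj hi
      have : 0 ≤ (B : ℤ) ^ 2 * ((B ^ 2) ^ j : ℕ) := by positivity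
      linarith
    · positivity
  obtain ⟨j, hj, ⟨i, hi, hd⟩, i', hi', hd'⟩ := exists_scale hX hp (by linarith) F hne hD
    (A := B ^ 2) (N := N) (by positivity) hN
    (fun j => hor ((B ^ 2) ^ j : ℕ)) (fun j => ver ((B ^ 2) ^ j : ℕ))
    (fun j => by rw [hor_pow]; congr 1; push_cast; ring)
    (fun j => by rw [ver_pow]; congr 1; push_cast; ring)
    (fun j hj i hi => by
      rw [hor_pow]
      refine almostInvariant_boxFinset (by omega) (n := (B : ℤ) ^ 2 * ((B ^ 2) ^ j : ℕ))
        ?_ ?_ ?_ (by exact_mod_cast boundR j hj) <;> simp only [hor, abs_zero]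
      · rw [abs_of_nonneg (by positivity)]
        exact idx j i hj hi.le
      all_goals positivity)
    (fun j hj i hi => by
      rw [ver_pow]
      refine almostInvariant_boxFinset (by omega) (n := (B : ℤ) ^ 2 * ((B ^ 2) ^ j : ℕ))
        ?_ ?_ ?_ (by exact_mod_cast boundR j hj) <;> simp only [ver, abs_zero]
      · positivity
      · rw [abs_of_nonneg (by positivity)]
        exact idx j i hj hi.le
      · positivity)
    (fun j hj x hx i hi => by
      rw [norm_sub_rev, mul_assoc, ← pow_succ]
      refine (hF x hx _ _ (smallh j i hj hi.le) (smallh j (i + 1) hj hi)).2.trans ?_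
      rw [pow_succ (hor _), inv_mul_cancel_left]
      gcongr
      exact (wordLength_hor_le _).trans_eq (by push_cast; rw [abs_of_nonneg (by positivity)]))
    (fun j hj x hx i hi => by
      rw [norm_sub_rev, mul_assoc, ← pow_succ]
      refine (hF x hx _ _ (smallv j i hj hi.le) (smallv j (i + 1) hj hi)).2.trans ?_
      rw [pow_succ (ver _), inv_mul_cancel_left]
      gcongr
      exact (wordLength_ver_le _).trans_eq (by push_cast; rw [abs_of_nonneg (by positivity)]))
  rw [← Nat.cast_pow (B ^ 2) j] at hd hd'
  refine single_scale hp hK hD hB hN (m := (B ^ 2) ^ j) (by positivity) (boundL j hj)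
    (boundR j hj) (fun x hx u v hu hv => (hF x hx u v hu hv).2) ?_ hi hi' hd hd'
  intro x hx v hv
  have h := (hF x hx 1 v (by simpa [IsSmall] using ⟨by omega, by positivity⟩) hv).1
  rwa [inv_one, one_mul, mul_one, norm_sub_rev] at h

/-- Since `p ≥ 2` and `N ≤ B ^ 2`, `N ^ (1 / p) ≤ √N ≤ B`, so the term `48 / B` is absorbed into the
other: `208 = 160 + 48`. -/
theorem rpow_le_of_bilipschitz (hX : PConvexWith X p K) (hp : 2 ≤ p) (hK : 1 ≤ K) {D : ℝ}
    (hD : 0 < D) {B N : ℕ} (hB : 0 < B) (hN : 0 < N) (hNB : N ≤ B ^ 2) {R : ℝ}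
    (hR : 240 * (N * ((B : ℝ) ^ 2) ^ N) ≤ R) {f : ball R → X}
    (hf : ∀ x y : ball R,
      (wordDist x y : ℝ) ≤ ‖f x - f y‖ ∧ ‖f x - f y‖ ≤ D * (wordDist x y : ℝ)) :
    (N : ℝ) ^ (1 / p) ≤ 208 * (K * D) := by
  have h := one_le_of_bilipschitz hX (by linarith) hK hD hB hN hR hf
  have hNR : (1 : ℝ) ≤ N := by exact_mod_cast hN
  have hBR : (0 : ℝ) < B := by exact_mod_cast hB
  have hr : 0 < (N : ℝ) ^ (1 / p) := by positivity
  have h1 : (N : ℝ) ^ (1 / p) ≤ B := by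
    calc (N : ℝ) ^ (1 / p) ≤ (N : ℝ) ^ (1 / 2 : ℝ) :=
          Real.rpow_le_rpow_of_exponent_le hNR (one_div_le_one_div_of_le (by norm_num) hp)
      _ = √N := (Real.sqrt_eq_rpow _).symm
      _ ≤ B := Real.sqrt_le_iff.2 ⟨hBR.le, by exact_mod_cast hNB⟩
  have h2 : 48 / (B : ℝ) ≤ 48 * K / (N : ℝ) ^ (1 / p) := by
    gcongr
    linarith
  have h3 : 1 ≤ D * (160 * K / (N : ℝ) ^ (1 / p) + 48 * K / (N : ℝ) ^ (1 / p)) := by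
    refine h.trans ?_
    gcongr
  rw [← add_div, ← mul_div_assoc, le_div_iff₀ hr] at h3
  linarith

end Embedding

/-! ### Choice of the parameters -/

/-- With `l = log R` and `t = log l`, take `N = ⌊l / (10 * t)⌋` and `B = ⌈√l⌉`. Then `B ^ 2 ≤ l ^ 2
= exp (2 * t)`, so `(B ^ 2) ^ N ≤ exp (l / 5)`, and the factors 240 and `N` cost at most `exp t`
each. -/
theorem exists_parameters {R : ℝ} (hR : 1 < R) (hR' : 100 ≤ Real.log (Real.log R)) :
    ∃ B N : ℕ, 0 < B ∧ 0 < N ∧ N ≤ B ^ 2 ∧ 240 * (N * ((B : ℝ) ^ 2) ^ N) ≤ R ∧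
      Real.log R / Real.log (Real.log R) ≤ 20 * N := by
  set l := Real.log R with hl
  set t := Real.log l with ht
  have hl0 : 0 < l := Real.log_pos hR
  have hlt : Real.exp t = l := Real.exp_log hl0
  have hRl : Real.exp l = R := Real.exp_log (by linarith)
  have hq : 1 + t + t ^ 2 / 2 ≤ l := hlt ▸ Real.quadratic_le_exp_of_nonneg (by linarith)
  have ht0 : 0 < t := by linarith
  have hlt2 : 50 * t ≤ l := by nlinarith
  have hN1 : 1 ≤ l / (10 * t) := by rw [le_div_iff₀ (by positivity)]; linarith
  have hN : 1 ≤ ⌊l / (10 * t)⌋₊ := Nat.le_floor (by exact_mod_cast hN1)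
  have hNle : (⌊l / (10 * t)⌋₊ : ℝ) ≤ l / (10 * t) := Nat.floor_le (by positivity)
  have hNlt : l / (10 * t) < ⌊l / (10 * t)⌋₊ + 1 := Nat.lt_floor_add_one _
  have hB : √l ≤ ⌈√l⌉₊ := Nat.le_ceil _
  have hBlt : (⌈√l⌉₊ : ℝ) < √l + 1 := Nat.ceil_lt_add_one (Real.sqrt_nonneg _)
  generalize ⌊l / (10 * t)⌋₊ = N at *
  generalize ⌈√l⌉₊ = B at *
  have hNR : (1 : ℝ) ≤ N := by exact_mod_cast hN
  have hs : √l ^ 2 = l := Real.sq_sqrt hl0.le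
  have hs1 : 1 ≤ √l := Real.one_le_sqrt.2 (by linarith)
  have hNl : (N : ℝ) ≤ l := hNle.trans (div_le_self hl0.le (by linarith))
  have hB2 : l ≤ (B : ℝ) ^ 2 := by rw [← hs]; gcongr
  have hB4 : (B : ℝ) ^ 2 ≤ Real.exp (2 * t) := by
    rw [two_mul, Real.exp_add, hlt]
    nlinarith
  refine ⟨B, N, ?_, hN, ?_, ?_, ?_⟩
  · exact_mod_cast (by linarith : (0 : ℝ) < B)
  · exact_mod_cast hNl.trans hB2
  · have h1 : ((B : ℝ) ^ 2) ^ N ≤ Real.exp (l / 5) := by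
      calc ((B : ℝ) ^ 2) ^ N ≤ Real.exp (2 * t) ^ N := by gcongr
        _ = Real.exp (N * (2 * t)) := (Real.exp_nat_mul _ _).symm
        _ ≤ Real.exp (l / 5) := by
          rw [le_div_iff₀ (by positivity)] at hNle
          exact Real.exp_le_exp.2 (by linarith)
    have h2 : (240 : ℝ) ≤ Real.exp t := by rw [hlt]; nlinarith
    calc 240 * (N * ((B : ℝ) ^ 2) ^ N) ≤ Real.exp t * (Real.exp t * Real.exp (l / 5)) := by
          gcongr
          rwa [hlt]
      _ = Real.exp (t + (t + l / 5)) := by rw [Real.exp_add, Real.exp_add]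
      _ ≤ Real.exp l := Real.exp_le_exp.2 (by linarith)
      _ = R := hRl
  · have : l / t = 10 * (l / (10 * t)) := by field_simp
    linarith

theorem one_quarter_le_loglog {R : ℝ} (hR : 4 ≤ R) : 1 / 4 ≤ Real.log (Real.log R) := by
  have h1 : 4 / 3 ≤ Real.log R := by
    have h2 : Real.log 4 = 2 * Real.log 2 := by
      rw [show (4 : ℝ) = 2 ^ 2 by norm_num, Real.log_pow]; norm_num
    have := Real.log_two_gt_d9
    have := Real.log_le_log (by norm_num) hR
    linarith
  have h3 := Real.one_sub_inv_le_log_of_pos (by linarith : 0 < Real.log R)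
  have h4 : (Real.log R)⁻¹ ≤ (4 / 3 : ℝ)⁻¹ := inv_anti₀ (by norm_num) h1
  norm_num at h4
  linarith

theorem log_div_loglog_le {R : ℝ} (hR : 4 ≤ R) (hR' : Real.log (Real.log R) < 100) :
    Real.log R / Real.log (Real.log R) ≤ 4 * Real.exp 100 := by
  have h := one_quarter_le_loglog hR
  have h1 : 0 < Real.log R := Real.log_pos (by linarith)
  have h2 : Real.log R ≤ Real.exp 100 := by
    rw [← Real.exp_log h1]; exact Real.exp_le_exp.2 hR'.le
  rw [div_le_iff₀ (by linarith)]
  nlinarith [Real.exp_pos 100]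

/-- When `log log R < 100` the left side is bounded and `K * D ≥ 1` suffices; this range dictates
the constant `4 * Real.exp 100`. -/
theorem log_div_loglog_rpow_le {X : Type*} [NormedAddCommGroup X] [NormedSpace ℝ X] {p K : ℝ}
    (hX : PConvexWith X p K) (hp : 2 ≤ p) (hK : 1 ≤ K) {D R : ℝ} (hD : 1 ≤ D) (hR : 4 ≤ R)
    {f : ball R → X} (hf : ∀ x y : ball R,
      (wordDist x y : ℝ) ≤ ‖f x - f y‖ ∧ ‖f x - f y‖ ≤ D * (wordDist x y : ℝ)) :
    (Real.log R / Real.log (Real.log R)) ^ (1 / p) ≤ 4 * Real.exp 100 * (K * D) := by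
  have hKD : 1 ≤ K * D := one_le_mul_of_one_le_of_one_le hK hD
  have hp0 : 0 ≤ 1 / p := by positivity
  have hp1 : 1 / p ≤ 1 := by rw [div_le_one (by linarith)]; linarith
  have hr : 0 ≤ Real.log R / Real.log (Real.log R) :=
    div_nonneg (Real.log_nonneg (by linarith)) (by linarith [one_quarter_le_loglog hR])
  have he : 101 + 100 ^ 2 / 2 ≤ Real.exp 100 := by
    have := Real.quadratic_le_exp_of_nonneg (x := 100) (by norm_num)
    linarith
  rcases lt_or_ge (Real.log (Real.log R)) 100 with h | h
  · calc _ ≤ (4 * Real.exp 100) ^ (1 / p) :=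
          Real.rpow_le_rpow hr (log_div_loglog_le hR h) hp0
      _ ≤ 4 * Real.exp 100 := Real.rpow_le_self_of_one_le (by linarith) hp1
      _ ≤ _ := le_mul_of_one_le_right (by positivity) hKD
  · obtain ⟨B, N, hB, hN, hNB, hBN, hle⟩ := exists_parameters (by linarith) h
    have h1 := rpow_le_of_bilipschitz hX hp hK (by linarith) hB hN hNB hBN hf
    calc _ ≤ (20 * N : ℝ) ^ (1 / p) := Real.rpow_le_rpow hr hle hp0
      _ = 20 ^ (1 / p) * (N : ℝ) ^ (1 / p) := Real.mul_rpow (by norm_num) (by positivity)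
      _ ≤ 20 * (208 * (K * D)) := by
          gcongr
          exact Real.rpow_le_self_of_one_le (by norm_num) hp1
      _ ≤ _ := by nlinarith

/-- There is no injection of a nontrivial ball into the zero space. -/
theorem nontrivial_of_bilipschitz {X : Type*} [NormedAddCommGroup X] {R : ℝ} (hR : 1 ≤ R)
    {f : ball R → X} (hf : ∀ x y : ball R, (wordDist x y : ℝ) ≤ ‖f x - f y‖) :
    Nontrivial X := by
  have h1 : (1 : Heis) ∈ ball R := by
    simp only [ball, wordDist, Set.mem_ofPred_eq, inv_one, one_mul, wordLength_one, Nat.cast_zero]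
    linarith
  have h2 : genA ∈ ball R := by
    have := wordLength_pow_le genA_mem_genSet 1
    rw [pow_one] at this
    simp only [ball, wordDist, Set.mem_ofPred_eq, inv_one, one_mul]
    exact (by exact_mod_cast this : (wordLength genA : ℝ) ≤ 1).trans hR
  by_contra hX
  rw [not_nontrivial_iff_subsingleton] at hX
  have h := hf ⟨1, h1⟩ ⟨genA, h2⟩
  rw [Subsingleton.elim (f ⟨1, h1⟩) (f ⟨genA, h2⟩), sub_self, norm_zero] at h
  have h3 := wordLength_pos genA_ne_one
  simp only [wordDist, inv_one, one_mul] at h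
  have : (wordLength genA : ℝ) ≤ (0 : ℕ) := by simpa using h
  exact absurd (Nat.cast_le.1 this) (by omega)

end HeisDistortion

theorem theorem1p3 :
    ∃ c : ℝ, 0 < c ∧
      ∀ (X : Type*) [NormedAddCommGroup X] [NormedSpace ℝ X] [CompleteSpace X] (p : ℝ),
        2 ≤ p → (∃ K : ℝ, 0 < K ∧ HeisDistortion.PConvexWith X p K) →
        ∀ R : ℝ, 4 ≤ R →
          ENNReal.ofReal c *
              ((ENNReal.ofReal (HeisDistortion.pConvexConst X p))⁻¹ *
                ENNReal.ofReal ((Real.log R / Real.log (Real.log R)) ^ (1 / p))) ≤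
            HeisDistortion.distortion X R := by
  refine ⟨(4 * Real.exp 100)⁻¹, by positivity, ?_⟩
  intro X _ _ _ p hp hK R hR
  refine le_iInf fun D => le_iInf fun hD => le_iInf fun ⟨f, hf⟩ => ?_
  -- For the zero space no map is admissible and the infimum is `∞`, so only nontrivial spaces
  -- remain.
  have : Nontrivial X :=
    HeisDistortion.nontrivial_of_bilipschitz (by linarith) fun x y => (hf x y).1
  have hp0 : 0 < p := by linarith
  have hD0 : 0 < D := by linarith
  have h1 : 1 ≤ HeisDistortion.pConvexConst X p :=
    le_csInf hK fun K hK => hK.2.one_le hp0 hK.1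
  -- The estimate holds for every admissible `K`; isolating `K` lets it pass to the infimum, which
  -- need not be known to be attained.
  have h2 : (4 * Real.exp 100)⁻¹ * (Real.log R / Real.log (Real.log R)) ^ (1 / p) / D ≤
      HeisDistortion.pConvexConst X p := by
    refine le_csInf hK fun K hK => ?_
    rw [div_le_iff₀ hD0, inv_mul_le_iff₀ (by positivity)]
    exact HeisDistortion.log_div_loglog_rpow_le hK.2 hp (hK.2.one_le hp0 hK.1) hD hR hf
  have hk : 0 < HeisDistortion.pConvexConst X p := by linarith
  rw [← ENNReal.ofReal_inv_of_pos hk, ← ENNReal.ofReal_mul (by positivity),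
    ← ENNReal.ofReal_mul (by positivity)]
  refine ENNReal.ofReal_le_ofReal ?_
  rw [div_le_iff₀ hD0, ← inv_mul_le_iff₀ hk] at h2
  linarith
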